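/- \textbf{Theorem (Weak PL condition).} Let $A\in\mathbb{R}^{n_x\times n_x}$, $B\in\mathbb{R}^{n_x\times n_u}$, $B_w\in\mathbb{R}^{n_x\times n_w}$, and let $Q\in\mathbb{R}^{n_x\times n_x}$, $R\in\mathbb{R}^{n_u\times n_u}$ be symmetric positive definite. Assume that $(A,B)$ is stabilizable, i.e. the set of stabilizing state-feedback gains \[ \mathcal{K}=\{K\in\mathbb{R}^{n_u\times n_x}\mid \rho(A+BK)<1\} \] ($\rho$ is the spectral radius) is nonempty, and that $B_w$ has full row rank. For $K\in\mathcal{K}$ let \[ J(K)=\max_{\omega\in[0,2\pi]}\sigma_{\max}\left(\begin{bmatrix}Q^{1/2}\\ R^{1/2}K\end{bmatrix}\left(e^{j\omega}I-(A+BK)\right)^{-1}B_w\right) \] be the closed-loop $\mathcal{H}_\infty$ norm with full state measurement ($C=I$), where $\sigma_{\max}$ is the maximum singular value. For $K\in\mathcal{K}$ let \[ \partial J(K)=\{G\in\mathbb{R}^{n_u\times n_x}\mid \operatorname{tr}(G^{\mathsf T}D)\le J^\circ(K;D)\ \text{for all } D\in\mathbb{R}^{n_u\times n_x}\},\qquad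 J^\circ(K;D)=\limsup_{K'\to K,\ t\downarrow 0}\frac{J(K'+tD)-J(K')}{t}, \] be the Clarke subdifferential of $J$ at $K$, and let $\mathrm{dist}(0,\partial J(K))=\inf_{G\in\partial J(K)}\|G\|_F$. Then the minimum $J^\star=\min_{K\in\mathcal{K}}J(K)$ exists, and for every $K\in\mathcal{K}$ there exists a constant $\mu_K>0$ such that \[ \mu_K\,\bigl(J(K)-J^\star\bigr)\le \mathrm{dist}(0,\partial J(K)). \] -/

import Mathlib

open scoped Topology MatrixOrder

noncomputable section

namespace HinfControl

/-- Entrywise inclusion of real matrices into complex matrices. -/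
def toComplex {m n : Type*} (M : Matrix m n ℝ) : Matrix m n ℂ :=
  M.map (fun a : ℝ => (a : ℂ))

/-- A real square matrix is Schur stable if its spectral radius (the maximum modulus of its
complex eigenvalues) is less than one. -/
def SchurStable {n : ℕ} (M : Matrix (Fin n) (Fin n) ℝ) : Prop :=
  spectralRadius ℂ (toComplex M) < 1

/-- Discrete-time stabilizability of the pair `(A, B)`. -/
def Stabilizable {nx nu : ℕ} (A : Matrix (Fin nx) (Fin nx) ℝ) (B : Matrix (Fin nx) (Fin nu) ℝ) :
    Prop :=
  ∃ F : Matrix (Fin nu) (Fin nx) ℝ, SchurStable (A + B * F)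

/-- The set of static output-feedback gains `K` for which `A + B K C` is Schur stable. -/
def stabilizingGains {nx nu ny : ℕ} (A : Matrix (Fin nx) (Fin nx) ℝ)
    (B : Matrix (Fin nx) (Fin nu) ℝ) (C : Matrix (Fin ny) (Fin nx) ℝ) :
    Set (Matrix (Fin nu) (Fin ny) ℝ) :=
  {K | SchurStable (A + B * K * C)}

/-- The maximum singular value of a complex matrix (Mathlib lists the singular values in
nonincreasing order, starting from index `0`). -/
def sigmaMax {m n : Type*} [Fintype m] [Fintype n] [DecidableEq n] (M : Matrix m n ℂ) : ℝ :=
  (Matrix.toEuclideanLin M).singularValues 0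

/-- The closed-loop transfer matrix from `w` to `z` at the frequency `ω`,
`[Q^{1/2}; R^{1/2} K C] (e^{jω} I - (A + B K C))⁻¹ B_w`. -/
def transferMatrix {nx nu ny nw : ℕ} (A : Matrix (Fin nx) (Fin nx) ℝ)
    (B : Matrix (Fin nx) (Fin nu) ℝ) (Bw : Matrix (Fin nx) (Fin nw) ℝ)
    (C : Matrix (Fin ny) (Fin nx) ℝ) (Q : Matrix (Fin nx) (Fin nx) ℝ)
    (R : Matrix (Fin nu) (Fin nu) ℝ) (K : Matrix (Fin nu) (Fin ny) ℝ) (ω : ℝ) :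
    Matrix (Fin nx ⊕ Fin nu) (Fin nw) ℂ :=
  toComplex (Matrix.fromRows (CFC.sqrt Q) (CFC.sqrt R * K * C)) *
    (Complex.exp (Complex.I * (ω : ℂ)) • (1 : Matrix (Fin nx) (Fin nx) ℂ) -
      toComplex (A + B * K * C))⁻¹ *
    toComplex Bw

/-- The closed-loop `H∞` norm `J(K) = max_{ω ∈ [0, 2π]} σ_max(T_zw(K, ω))`. It is used as the
cost of stabilizing gains `K` only; for these the inverse in `transferMatrix` is a genuine inverse
at every `ω`, and the supremum of a continuous function over `[0, 2π]` is a maximum. -/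
def cost {nx nu ny nw : ℕ} (A : Matrix (Fin nx) (Fin nx) ℝ)
    (B : Matrix (Fin nx) (Fin nu) ℝ) (Bw : Matrix (Fin nx) (Fin nw) ℝ)
    (C : Matrix (Fin ny) (Fin nx) ℝ) (Q : Matrix (Fin nx) (Fin nx) ℝ)
    (R : Matrix (Fin nu) (Fin nu) ℝ) (K : Matrix (Fin nu) (Fin ny) ℝ) : ℝ :=
  sSup ((fun ω : ℝ => sigmaMax (transferMatrix A B Bw C Q R K ω)) '' Set.Icc 0 (2 * Real.pi))

/-- The Clarke generalized directional derivative
`f°(x; D) = limsup_{y → x, t ↓ 0} (f (y + t D) - f y) / t`. It depends only on the values of `f`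
near `x`. -/
def clarkeDeriv {m n : Type*} (f : Matrix m n ℝ → ℝ) (x D : Matrix m n ℝ) : EReal :=
  Filter.limsup (fun p : Matrix m n ℝ × ℝ => (((f (p.1 + p.2 • D) - f p.1) / p.2 : ℝ) : EReal))
    (𝓝 x ×ˢ 𝓝[>] (0 : ℝ))

/-- The Clarke subdifferential at `x` of a function that is locally Lipschitz near `x`: all `G`
with `⟨G, D⟩ = tr(Gᵀ D) ≤ f°(x; D)` for every direction `D`. -/
def clarkeSubdifferential {m n : Type*} [Fintype m] [Fintype n] (f : Matrix m n ℝ → ℝ)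
    (x : Matrix m n ℝ) : Set (Matrix m n ℝ) :=
  {G | ∀ D : Matrix m n ℝ, (((G.transpose * D).trace : ℝ) : EReal) ≤ clarkeDeriv f x D}

/-- The distance from the origin to a nonempty set of real matrices in the Frobenius norm
`‖G‖_F = (tr(Gᵀ G))^{1/2}`. -/
def distZero {m n : Type*} [Fintype m] [Fintype n] (S : Set (Matrix m n ℝ)) : ℝ :=
  sInf ((fun G : Matrix m n ℝ => Real.sqrt (G.transpose * G).trace) '' S)

end HinfControl

end

/-!
# Gradient dominance of state feedback `H∞` control

The proof replaces the `H∞` norm by storage matrices. For a stabilizing gain `K`, the bound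
`J(K) ≤ γ` holds if and only if there is a positive semidefinite `X` such that `(K, X, γ²)`
satisfies the dissipation inequality of the dual closed loop
`x⁺ = (A + B K)ᵀ x + [Q^{1/2}; R^{1/2} K]ᵀ y` with output `Bwᵀ x` (`Plant.Certificate`).

* A certificate bounds the transfer matrix pointwise on the unit circle
  (`Plant.Certificate.hinf_le`). Conversely, `exists_dissipative` takes for `X` the available
  storage, the supremum of `∑ₖ |Bwᵀ xₖ|² - γ² |yₖ|²` over all trajectories of finite support with
  a given initial state. These trajectories are pairs of polynomial vectors, so that the frequency
  domain bound applies pointwise on the circle and Parseval's identity turns it into a bound for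
  the sums. The dual input matrix is surjective since `Q` is invertible, so every state is reached
  from the origin in one step and steered to it in one step: the supremum is finite, over a
  nonempty set, even at the critical level `γ = J(K)`. It is a quadratic form in the initial state
  by `exists_matrix_isLUB_fiber`.

* As `Bw` has full row rank, certificates are uniformly positive definite, so they imply stability
  and the certificates of level at most `γ` form a compact set. Hence a minimizer exists
  (`Plant.exists_optimal_gain`).

* The certificates are convex in `(X, K X, γ²)` (`Plant.Certificate.convex`). If
  `J(K₁) < J(K₀)`, the segment between certificates of `K₀` and `K₁` gives, for each `t ∈ [0, 1]`,
  a direction `D`, bounded uniformly in `t`, with `J(K₀ + t D) ≤ J(K₀) - c t`, as long as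
  `K₀ + t D` has no closed-loop eigenvalue on the unit circle (`Plant.exists_descent`).

* The transfer matrix has a second-order expansion in the gain that is uniform on the unit circle,
  so `J`, a supremum of norms, is locally convex up to a quadratic error
  (`Plant.Regular.exists_weakly_convex`). Difference quotients with a small step at gains near
  `K₀` are therefore controlled by the quotient with a fixed step `s` at `K₀`, and the direction
  from the previous item for a small `t = s` is a strict descent direction for the Clarke
  derivative (`Plant.Regular.exists_clarkeDeriv_le`). This keeps all Clarke subgradients at a
  nonoptimal gain away from zero. The subdifferential is not empty, because it contains the
  gradient of a smooth minorant that touches `J` at `K₀`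
  (`Plant.Regular.clarkeSubdifferential_nonempty`), so the distance in the theorem is not the junk
  value of an infimum over the empty set.
-/

noncomputable section

namespace HinfControl

open Filter Matrix Polynomial

/-! ### Partial maximization of quadratic forms -/

/-- Maximizing a quadratic form over the fibres of a linear map yields a quadratic form: the
defect `r s = V (π s) - b s s` of a point `s` from the fibrewise supremum `V` satisfies
`r (s + t) ≤ 2 r s + 2 r t`, so that linear combinations of almost optimal points are almost
optimal, and `V` is a pointwise limit of quadratic forms. -/
theorem exists_matrix_isLUB_fiber {n S : Type*} [Fintype n] [DecidableEq n] [AddCommGroup S]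
    [Module ℝ S] (b : S →ₗ[ℝ] S →ₗ[ℝ] ℝ) (π : S →ₗ[ℝ] (n → ℝ))
    (hπ : Function.Surjective π) (hb : ∀ x, ∃ c, ∀ s, π s = x → b s s ≤ c) :
    ∃ X : Matrix n n ℝ, Xᵀ = X ∧ ∀ x, IsLUB {c | ∃ s, π s = x ∧ b s s = c} (x ⬝ᵥ X *ᵥ x) := by
  have hV : ∀ x, ∃ v, IsLUB {c | ∃ s, π s = x ∧ b s s = c} v := by
    intro x
    obtain ⟨s, hs⟩ := hπ x
    obtain ⟨c, hc⟩ := hb x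
    refine ⟨_, isLUB_csSup ⟨_, s, hs, rfl⟩ ⟨c, ?_⟩⟩
    rintro _ ⟨s, hs, rfl⟩
    exact hc s hs
  choose V hV using hV
  have hle : ∀ s, b s s ≤ V (π s) := fun s => (hV _).1 ⟨s, rfl, rfl⟩
  have hlub : ∀ x c, (∀ s, π s = x → b s s ≤ c) → V x ≤ c := by
    intro x c h
    refine (hV x).2 ?_
    rintro _ ⟨s, hs, rfl⟩
    exact h s hs
  have hV0 : V 0 ≤ 0 := by
    have : V 0 ≤ V 0 / 4 := by
      refine hlub 0 _ fun s hs => ?_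
      have := hle ((2 : ℝ) • s)
      simp only [map_smul, hs, smul_zero, LinearMap.smul_apply, smul_eq_mul] at this
      linarith
    linarith
  have hsmul : ∀ (c : ℝ) x, V (c • x) ≤ c ^ 2 * V x := by
    intro c x
    rcases eq_or_ne c 0 with rfl | hc
    · simpa using hV0
    · refine hlub _ _ fun s hs => ?_
      have := hle (c⁻¹ • s)
      simp only [map_smul, hs, LinearMap.smul_apply, smul_eq_mul, smul_smul,
        inv_mul_cancel₀ hc, one_smul] at this
      calc b s s = c ^ 2 * (c⁻¹ * (c⁻¹ * b s s)) := by field_simp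
        _ ≤ _ := by gcongr
  have hpar : ∀ x y, V (x + y) + V (x - y) ≤ 2 * V x + 2 * V y := by
    intro x y
    rw [← le_sub_iff_add_le]
    refine hlub _ _ fun u hu => ?_
    rw [le_sub_comm]
    refine hlub _ _ fun v hv => ?_
    have h1 := hle ((1 / 2 : ℝ) • (u + v))
    have h2 := hle ((1 / 2 : ℝ) • (u - v))
    have e1 : (1 / 2 : ℝ) • (x + y + (x - y)) = x := by ext i; simp; ring
    have e2 : (1 / 2 : ℝ) • (x + y - (x - y)) = y := by ext i; simp; ring
    simp only [map_smul, map_add, map_sub, hu, hv, e1, e2, LinearMap.smul_apply,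
      LinearMap.add_apply, LinearMap.sub_apply, smul_eq_mul] at h1 h2
    linarith
  set r : S → ℝ := fun s => V (π s) - b s s with hr
  have hr0 : ∀ s, 0 ≤ r s := fun s => sub_nonneg.2 (hle s)
  have hradd : ∀ s t, r (s + t) ≤ 2 * r s + 2 * r t := by
    intro s t
    have h1 := hpar (π s) (π t)
    have h2 := hle (s - t)
    simp only [hr, map_add, map_sub, LinearMap.add_apply, LinearMap.sub_apply] at h1 h2 ⊢
    linarith
  have hrsmul : ∀ (c : ℝ) s, r (c • s) ≤ c ^ 2 * r s := by
    intro c s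
    have := hsmul c (π s)
    simp only [hr, map_smul, LinearMap.smul_apply, smul_eq_mul]
    linarith
  -- `s i k` is a point over the `i`-th basis vector that is optimal up to `1 / (k + 1)`.
  have hnear : ∀ (i : n) (k : ℕ), ∃ s, π s = Pi.single i 1 ∧ r s < 1 / ((k : ℝ) + 1) := by
    intro i k
    by_contra! hcon
    have : V (Pi.single i 1) ≤ V (Pi.single i 1) - 1 / ((k : ℝ) + 1) := by
      refine hlub _ _ fun s hs => ?_
      have := hcon s hs
      simp only [hr, hs] at this
      linarith
    have : (0 : ℝ) < 1 / ((k : ℝ) + 1) := by positivity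
    linarith
  choose s hs hsr using hnear
  have hlim : ∀ x : n → ℝ, ∀ t : Finset n,
      Tendsto (fun k => r (∑ i ∈ t, x i • s i k)) atTop (𝓝 0) := by
    intro x t
    induction t using Finset.induction_on with
    | empty =>
      have : r 0 = 0 := le_antisymm (by simpa [hr] using hV0) (hr0 0)
      simp [this]
    | insert a t ha ih =>
      have h1 : Tendsto (fun k : ℕ => 2 * (x a ^ 2 * (1 / ((k : ℝ) + 1)))
          + 2 * r (∑ i ∈ t, x i • s i k)) atTop (𝓝 0) := by
        simpa using ((tendsto_one_div_add_atTop_nhds_zero_nat.const_mul (x a ^ 2)).const_mul 2).add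
          (ih.const_mul 2)
      refine squeeze_zero (fun k => hr0 _) (fun k => ?_) h1
      rw [Finset.sum_insert ha]
      refine (hradd _ _).trans ?_
      gcongr
      refine (hrsmul _ _).trans ?_
      gcongr
      exact (hsr a k).le
  have hπs : ∀ x k, π (∑ i, x i • s i k) = x := by
    intro x k
    simp only [map_sum, map_smul, hs]
    ext j
    simp [Finset.sum_apply, Pi.single_apply]
  -- `M k` represents the form `b` on the linear section `x ↦ ∑ i, x i • s i k` of `π`.
  set M : ℕ → Matrix n n ℝ :=
    fun k => Matrix.of fun i j => (b (s i k) (s j k) + b (s j k) (s i k)) / 2 with hM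
  have hMq : ∀ x k, x ⬝ᵥ M k *ᵥ x = b (∑ i, x i • s i k) (∑ i, x i • s i k) := by
    intro x k
    have e : b (∑ i, x i • s i k) (∑ i, x i • s i k)
        = ∑ i, ∑ j, x i * x j * b (s i k) (s j k) := by
      simp only [map_sum, LinearMap.sum_apply, map_smul, LinearMap.smul_apply, smul_eq_mul,
        Finset.mul_sum]
      rw [Finset.sum_comm]
      refine Finset.sum_congr rfl fun i _ => Finset.sum_congr rfl fun j _ => by ring
    have e' : ∑ i, ∑ j, x i * x j * b (s i k) (s j k)
        = ∑ i, ∑ j, x i * x j * b (s j k) (s i k) := by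
      rw [Finset.sum_comm]
      refine Finset.sum_congr rfl fun i _ => Finset.sum_congr rfl fun j _ => by ring
    have e'' : x ⬝ᵥ M k *ᵥ x = (∑ i, ∑ j, x i * x j * b (s i k) (s j k)
        + ∑ i, ∑ j, x i * x j * b (s j k) (s i k)) / 2 := by
      simp only [dotProduct, mulVec, hM, Matrix.of_apply, Finset.mul_sum, ← Finset.sum_add_distrib,
        Finset.sum_div]
      refine Finset.sum_congr rfl fun i _ => Finset.sum_congr rfl fun j _ => by ring
    rw [e'', ← e', e]
    ring
  have hMlim : ∀ x, Tendsto (fun k => x ⬝ᵥ M k *ᵥ x) atTop (𝓝 (V x)) := by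
    intro x
    have := (tendsto_const_nhds (x := V x)).sub (hlim x Finset.univ)
    simp only [hr, hπs, sub_zero, sub_sub_cancel] at this
    simpa only [hMq] using this
  have hMsymm : ∀ k, (M k)ᵀ = M k := by
    intro k
    ext i j
    simp [hM, add_comm]
  have hpolar : ∀ k i j, M k i j = ((Pi.single i 1 + Pi.single j 1) ⬝ᵥ M k *ᵥ
      (Pi.single i 1 + Pi.single j 1) - (Pi.single i 1) ⬝ᵥ M k *ᵥ (Pi.single i 1)
      - (Pi.single j 1) ⬝ᵥ M k *ᵥ (Pi.single j 1)) / 2 := by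
    intro k i j
    have : M k j i = M k i j := congrFun (congrFun (hMsymm k) i) j
    simp only [mulVec_add, add_dotProduct, dotProduct_add, mulVec_single_one,
      single_one_dotProduct, col_apply, this]
    ring
  refine ⟨Matrix.of fun i j => (V (Pi.single i 1 + Pi.single j 1) - V (Pi.single i 1)
    - V (Pi.single j 1)) / 2, ?_, ?_⟩
  · ext i j
    simp only [Matrix.transpose_apply, Matrix.of_apply, add_comm (Pi.single j 1 : n → ℝ)]
    ring
  · intro x
    have hentry : ∀ i j, Tendsto (fun k => M k i j) atTop (𝓝 ((V (Pi.single i 1 + Pi.single j 1)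
        - V (Pi.single i 1) - V (Pi.single j 1)) / 2)) := by
      intro i j
      simp only [hpolar]
      exact (((hMlim _).sub (hMlim _)).sub (hMlim _)).div_const 2
    have h2 : Tendsto (fun k => x ⬝ᵥ M k *ᵥ x) atTop (𝓝 (x ⬝ᵥ (Matrix.of fun i j =>
        (V (Pi.single i 1 + Pi.single j 1) - V (Pi.single i 1)
        - V (Pi.single j 1)) / 2 : Matrix n n ℝ) *ᵥ x)) := by
      simp only [dotProduct, mulVec, Matrix.of_apply]
      exact tendsto_finsetSum _ fun i _ => (tendsto_finsetSum _ fun j _ =>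
        (hentry i j).mul_const _).const_mul _
    rw [tendsto_nhds_unique h2 (hMlim x)]
    exact hV x

/-! ### The bounded real lemma -/

/-- The dissipation inequality with storage function `x ↦ xᵀ X x` and supply rate
`g |y|² - |H x|²` for the system `x⁺ = F x + G y` with output `H x`. -/
def Dissipative {n m l : Type*} [Fintype n] [Fintype m] [Fintype l] (F : Matrix n n ℝ)
    (G : Matrix n m ℝ) (H : Matrix l n ℝ) (X : Matrix n n ℝ) (g : ℝ) : Prop :=
  ∀ x y, (F *ᵥ x + G *ᵥ y) ⬝ᵥ X *ᵥ (F *ᵥ x + G *ᵥ y) + (H *ᵥ x) ⬝ᵥ (H *ᵥ x) ≤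
    x ⬝ᵥ X *ᵥ x + g * (y ⬝ᵥ y)

/-- The squared Euclidean norm of a complex vector. -/
def normSq {n : Type*} [Fintype n] (v : n → ℂ) : ℝ := ∑ i, ‖v i‖ ^ 2

/-- The `ℓ²` inner product of the coefficient sequences of two real polynomials. -/
def coeffInner : ℝ[X] →ₗ[ℝ] ℝ[X] →ₗ[ℝ] ℝ :=
  LinearMap.mk₂ ℝ (fun p q => p.sum fun k a => a * q.coeff k)
    (fun p p' q => sum_add_index p p' _ (by simp) (by intros; ring))
    (fun c p q => by
      rw [sum_smul_index p c _ (by simp), Polynomial.sum_def, Polynomial.sum_def, smul_eq_mul,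
        Finset.mul_sum]
      exact Finset.sum_congr rfl fun _ _ => by ring)
    (fun p q q' => by simp [Polynomial.sum_def, mul_add, Finset.sum_add_distrib])
    (fun c p q => by
      simp only [Polynomial.sum_def, smul_eq_mul, Finset.mul_sum, coeff_smul]
      exact Finset.sum_congr rfl fun _ _ => by ring)

theorem coeffInner_apply (p q : ℝ[X]) :
    coeffInner p q = p.sum fun k a => a * q.coeff k := rfl

theorem coeffInner_C_add_X_mul (c : ℝ) (p : ℝ[X]) :
    coeffInner (C c + X * p) (C c + X * p) = c ^ 2 + coeffInner p p := by
  have h1 : coeffInner (C c) (C c) = c ^ 2 := by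
    simp [coeffInner_apply, sum_C_index, sq]
  have h2 : coeffInner (C c) (X * p) = 0 := by
    simp [coeffInner_apply, sum_C_index]
  have h3 : coeffInner (X * p) (C c) = 0 := by
    simp only [coeffInner_apply, Polynomial.sum_def]
    refine Finset.sum_eq_zero fun k _ => ?_
    rcases k with _ | k <;> simp [coeff_C]
  have h4 : coeffInner (X * p) (X * p) = coeffInner p p := by
    have hdeg : (X * p).natDegree < p.natDegree + 1 + 1 := by
      have := natDegree_mul_le (p := X) (q := p)
      rw [natDegree_X] at this
      omega
    rw [coeffInner_apply, coeffInner_apply, sum_over_range' (X * p) (by simp) _ hdeg,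
      Finset.sum_range_succ', sum_over_range' p (by simp) (p.natDegree + 1) (by omega)]
    simp
  simp only [map_add, LinearMap.add_apply, h1, h2, h3, h4]
  ring

/-- Parseval's identity. -/
theorem coeffInner_self (p : ℝ[X]) :
    coeffInner p p = Real.circleAverage (fun z : ℂ => ‖aeval z p‖ ^ 2) 0 1 := by
  have h := sum_sq_norm_coeff_eq_circleAverage (p.map (algebraMap ℝ ℂ))
  simp only [eval_map_algebraMap] at h
  rw [← h, support_map_of_injective _ (algebraMap ℝ ℂ).injective]
  simp [coeffInner_apply, Polynomial.sum_def, sq]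

section KYP

variable {n m l : Type*} [Fintype n] [Fintype m] [Fintype l]

/-- The quadratic functional `∑ₖ |H xₖ|² - g |yₖ|²` of a finitely supported trajectory, polarized;
the sequences `x` and `y` are encoded as vectors of polynomials. -/
def supplyForm (H : Matrix l n ℝ) (g : ℝ) :
    ((n → ℝ[X]) × (m → ℝ[X])) →ₗ[ℝ] ((n → ℝ[X]) × (m → ℝ[X])) →ₗ[ℝ] ℝ :=
  LinearMap.mk₂ ℝ (fun s t =>
      ∑ i, coeffInner ((H.map C *ᵥ s.1) i) ((H.map C *ᵥ t.1) i)
        - g * ∑ j, coeffInner (s.2 j) (t.2 j))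
    (fun s s' t => by
      simp only [Prod.fst_add, Prod.snd_add, mulVec_add, Pi.add_apply, map_add,
        LinearMap.add_apply, Finset.sum_add_distrib]
      ring)
    (fun c s t => by
      simp only [Prod.smul_fst, Prod.smul_snd, mulVec_smul, Pi.smul_apply, map_smul,
        LinearMap.smul_apply, smul_eq_mul, ← Finset.mul_sum]
      ring)
    (fun s t t' => by
      simp only [Prod.fst_add, Prod.snd_add, mulVec_add, Pi.add_apply, map_add,
        Finset.sum_add_distrib]
      ring)
    (fun c s t => by
      simp only [Prod.smul_fst, Prod.smul_snd, mulVec_smul, Pi.smul_apply, map_smul,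
        smul_eq_mul, ← Finset.mul_sum]
      ring)

theorem supplyForm_apply (H : Matrix l n ℝ) (g : ℝ) (s t : (n → ℝ[X]) × (m → ℝ[X])) :
    supplyForm H g s t = ∑ i, coeffInner ((H.map C *ᵥ s.1) i) ((H.map C *ᵥ t.1) i)
        - g * ∑ j, coeffInner (s.2 j) (t.2 j) := rfl

/-- The finitely supported trajectories of `x⁺ = F x + G y`, in terms of the generating polynomials
`p = ∑ₖ xₖ Xᵏ` and `r = ∑ₖ yₖ Xᵏ`. -/
def finiteTrajectories (F : Matrix n n ℝ) (G : Matrix n m ℝ) :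
    Submodule ℝ ((n → ℝ[X]) × (m → ℝ[X])) where
  carrier := {s | ∀ i, s.1 i =
    C ((s.1 i).coeff 0) + X * ((F.map C *ᵥ s.1) i + (G.map C *ᵥ s.2) i)}
  zero_mem' := by simp
  add_mem' := by
    intro s t hs ht i
    simp only [Prod.fst_add, Prod.snd_add, mulVec_add, Pi.add_apply, coeff_add, map_add]
    linear_combination hs i + ht i
  smul_mem' := by
    intro c s hs i
    simp only [Prod.smul_fst, Prod.smul_snd, mulVec_smul, Pi.smul_apply, smul_eq_C_mul, coeff_C_mul,
      C_mul]
    linear_combination C c * hs i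

theorem mem_finiteTrajectories {F : Matrix n n ℝ} {G : Matrix n m ℝ}
    {s : (n → ℝ[X]) × (m → ℝ[X])} : s ∈ finiteTrajectories F G ↔ ∀ i, s.1 i =
    C ((s.1 i).coeff 0) + X * ((F.map C *ᵥ s.1) i + (G.map C *ᵥ s.2) i) := Iff.rfl

theorem map_C_mulVec_C_add_X_mul {k : Type*} (M : Matrix k n ℝ) (x : n → ℝ) (p : n → ℝ[X])
    (i : k) : (M.map C *ᵥ fun j => C (x j) + X * p j) i
      = C ((M *ᵥ x) i) + X * (M.map C *ᵥ p) i := by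
  simp only [mulVec, dotProduct, map_apply, mul_add, Finset.sum_add_distrib, map_sum, map_mul,
    Finset.mul_sum]
  congr 1
  exact Finset.sum_congr rfl fun _ _ => by ring

/-- Prepending one time step to a trajectory. -/
theorem cons_mem_finiteTrajectories {F : Matrix n n ℝ} {G : Matrix n m ℝ}
    {s : (n → ℝ[X]) × (m → ℝ[X])} (hs : s ∈ finiteTrajectories F G) (x : n → ℝ) (y : m → ℝ)
    (hxy : ∀ i, (s.1 i).coeff 0 = (F *ᵥ x + G *ᵥ y) i) :
    ((fun i => C (x i) + X * s.1 i, fun j => C (y j) + X * s.2 j) :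
      (n → ℝ[X]) × (m → ℝ[X])) ∈ finiteTrajectories F G := by
  intro i
  simp only [map_C_mulVec_C_add_X_mul]
  have h := hs i
  rw [hxy i, Pi.add_apply, C_add] at h
  simp only [coeff_add, coeff_C_zero, mul_coeff_zero, coeff_X_zero, zero_mul, add_zero]
  linear_combination X * h

theorem supplyForm_cons (H : Matrix l n ℝ) (g : ℝ) (s : (n → ℝ[X]) × (m → ℝ[X])) (x : n → ℝ)
    (y : m → ℝ) : supplyForm H g (fun i => C (x i) + X * s.1 i, fun j => C (y j) + X * s.2 j)
      (fun i => C (x i) + X * s.1 i, fun j => C (y j) + X * s.2 j)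
      = (H *ᵥ x) ⬝ᵥ (H *ᵥ x) - g * (y ⬝ᵥ y) + supplyForm H g s s := by
  simp only [supplyForm_apply, map_C_mulVec_C_add_X_mul, coeffInner_C_add_X_mul,
    Finset.sum_add_distrib, dotProduct, sq]
  ring

theorem aeval_map_C_mulVec {k : Type*} (M : Matrix k n ℝ) (p : n → ℝ[X]) (z : ℂ) (i : k) :
    aeval z ((M.map C *ᵥ p) i) = (toComplex M *ᵥ fun j => aeval z (p j)) i := by
  simp [mulVec, dotProduct, toComplex]

theorem circleIntegrable_normSq_aeval (p : n → ℝ[X]) :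
    CircleIntegrable (fun z : ℂ => normSq fun i => aeval z (p i)) 0 1 :=
  ContinuousOn.circleIntegrable zero_le_one (Continuous.continuousOn
    (continuous_finsetSum _ fun i _ => ((Polynomial.continuous_aeval (p i)).norm.pow 2)))

theorem sum_coeffInner_self (p : n → ℝ[X]) : ∑ i, coeffInner (p i) (p i) =
    Real.circleAverage (fun z : ℂ => normSq fun i => aeval z (p i)) 0 1 := by
  simp only [coeffInner_self, normSq]
  exact (Real.circleAverage_fun_sum fun i _ => ContinuousOn.circleIntegrable zero_le_one
    (Continuous.continuousOn ((Polynomial.continuous_aeval (p i)).norm.pow 2))).symm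

/-- A trajectory that starts at the origin satisfies the frequency domain bound at every point of
the unit circle; averaging over the circle gives the bound for its coefficients by Parseval. -/
theorem supplyForm_nonpos {F : Matrix n n ℝ} {G : Matrix n m ℝ} {H : Matrix l n ℝ} {g : ℝ}
    (hfreq : ∀ z : ℂ, ‖z‖ = 1 → ∀ (x : n → ℂ) (y : m → ℂ),
      z • x = toComplex F *ᵥ x + toComplex G *ᵥ y → normSq (toComplex H *ᵥ x) ≤ g * normSq y)
    {s : (n → ℝ[X]) × (m → ℝ[X])} (hs : s ∈ finiteTrajectories F G)
    (h0 : ∀ i, (s.1 i).coeff 0 = 0) : supplyForm H g s s ≤ 0 := by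
  rw [supplyForm_apply, sub_nonpos, sum_coeffInner_self, sum_coeffInner_self, ← smul_eq_mul,
    ← Real.circleAverage_fun_smul]
  refine Real.circleAverage_mono (circleIntegrable_normSq_aeval _)
    ((circleIntegrable_normSq_aeval _).const_smul (a := g)) fun z hz => ?_
  have hz1 : ‖z‖ = 1 := by simpa using hz
  have hz0 : z ≠ 0 := by
    rintro rfl
    simp at hz1
  -- Multiplication by `z` is the delay by one step, so the frequency is `z⁻¹`.
  have hzi : ‖z⁻¹‖ = 1 := by simp [hz1]
  have hx : z⁻¹ • (fun j => aeval z (s.1 j)) = toComplex F *ᵥ (fun j => aeval z (s.1 j))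
      + toComplex G *ᵥ (fun j => aeval z (s.2 j)) := by
    ext i
    have h := congrArg (aeval z) (mem_finiteTrajectories.1 hs i)
    rw [h0 i, map_add, map_mul, map_add, aeval_X, aeval_map_C_mulVec, aeval_map_C_mulVec,
      map_zero, map_zero, zero_add] at h
    rw [Pi.smul_apply, smul_eq_mul, Pi.add_apply, h, inv_mul_cancel_left₀ hz0]
  have := hfreq z⁻¹ hzi _ _ hx
  simp only [aeval_map_C_mulVec, smul_eq_mul]
  exact this

/-- The necessity part of the discrete-time bounded real lemma, for surjective input matrices and
a non-strict frequency domain bound. The storage function is the available storage, i.e. the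
supremum of the supply over all trajectories of finite support with a given initial state. -/
theorem exists_dissipative [DecidableEq n] {F : Matrix n n ℝ} {G : Matrix n m ℝ}
    {H : Matrix l n ℝ} {g : ℝ} (Gi : Matrix m n ℝ) (hG : G * Gi = 1)
    (hF : ∀ x, Tendsto (fun k : ℕ => (F ^ k) *ᵥ x) atTop (𝓝 0))
    (hfreq : ∀ z : ℂ, ‖z‖ = 1 → ∀ (x : n → ℂ) (y : m → ℂ),
      z • x = toComplex F *ᵥ x + toComplex G *ᵥ y → normSq (toComplex H *ᵥ x) ≤ g * normSq y) :
    ∃ X : Matrix n n ℝ, Xᵀ = X ∧ (∀ x, 0 ≤ x ⬝ᵥ X *ᵥ x) ∧ Dissipative F G H X g := by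
  set S := finiteTrajectories F G
  set π : S →ₗ[ℝ] (n → ℝ) :=
    { toFun := fun s i => (s.1.1 i).coeff 0
      map_add' := fun s t => by ext i; simp
      map_smul' := fun c s => by ext i; simp } with hπ
  have hGi : ∀ x, G *ᵥ (Gi *ᵥ x) = x := fun x => by rw [mulVec_mulVec, hG, one_mulVec]
  -- The fibre over `x` contains the trajectory that reaches the origin after one step; prepending
  -- the step from the origin to `x` bounds the supply on the fibre from above.
  obtain ⟨X, hX, hlub⟩ := exists_matrix_isLUB_fiber
    ((supplyForm H g).domRestrict₁₂ S S) π (by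
      intro x
      have := cons_mem_finiteTrajectories (F := F) (G := G) (Submodule.zero_mem S) x
        (Gi *ᵥ (-(F *ᵥ x))) (by simp [hGi])
      refine ⟨⟨_, this⟩, ?_⟩
      ext i
      simp [hπ])
    (by
      intro x
      refine ⟨g * ((Gi *ᵥ x) ⬝ᵥ (Gi *ᵥ x)), fun s hs => ?_⟩
      have h1 := cons_mem_finiteTrajectories s.2 0 (Gi *ᵥ x) (by
        intro i
        simp only [mulVec_zero, hGi, zero_add]
        exact congrFun hs i)
      have h2 := supplyForm_nonpos hfreq h1 (by simp)
      rw [supplyForm_cons, mulVec_zero, zero_dotProduct] at h2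
      simp only [LinearMap.domRestrict₁₂_apply]
      linarith)
  have hdiss : Dissipative F G H X g := by
    intro x y
    rw [← le_sub_iff_add_le]
    refine (hlub _).2 ?_
    rintro _ ⟨s, hs, rfl⟩
    have h1 := cons_mem_finiteTrajectories s.2 x y (fun i => congrFun hs i)
    have h2 := (hlub x).1 ⟨⟨_, h1⟩, by ext i; simp [hπ], rfl⟩
    simp only [LinearMap.domRestrict₁₂_apply] at h2 ⊢
    rw [supplyForm_cons] at h2
    linarith
  refine ⟨X, hX, fun x => ?_, hdiss⟩
  -- Along the free motion the storage decreases, and it tends to its value at the origin.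
  have hmono : ∀ k : ℕ, ((F ^ k) *ᵥ x) ⬝ᵥ X *ᵥ ((F ^ k) *ᵥ x) ≤ x ⬝ᵥ X *ᵥ x := by
    intro k
    induction k with
    | zero => simp
    | succ k ih =>
      have h := hdiss ((F ^ k) *ᵥ x) 0
      have hn : 0 ≤ (H *ᵥ ((F ^ k) *ᵥ x)) ⬝ᵥ (H *ᵥ ((F ^ k) *ᵥ x)) :=
        Finset.sum_nonneg fun i _ => mul_self_nonneg _
      simp only [mulVec_zero, add_zero, dotProduct_zero, mul_zero] at h
      rw [pow_succ', ← mulVec_mulVec]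
      linarith
  have hcont : Continuous fun v : n → ℝ => v ⬝ᵥ X *ᵥ v := by fun_prop
  have := (hcont.tendsto 0).comp (hF x)
  simp only [zero_dotProduct] at this
  exact le_of_tendsto' this hmono

end KYP

end HinfControl

namespace HinfControl

open Filter Matrix
open scoped Matrix.Norms.L2Operator

/-! ### Singular values, operator norms and complexification -/

section Norms

variable {n m l : Type*} [Fintype n] [Fintype m] [Fintype l]

theorem normSq_eq_norm_sq (v : n → ℂ) : normSq v = ‖WithLp.toLp 2 v‖ ^ 2 := by
  simp [normSq, EuclideanSpace.norm_sq_eq]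

theorem normSq_nonneg (v : n → ℂ) : 0 ≤ normSq v :=
  Finset.sum_nonneg fun _ _ => by positivity

theorem normSq_pos {v : n → ℂ} (hv : v ≠ 0) : 0 < normSq v := by
  rw [normSq_eq_norm_sq]
  have : WithLp.toLp 2 v ≠ 0 := by simpa using hv
  positivity

theorem normSq_mulVec_le [DecidableEq n] (M : Matrix m n ℂ) (v : n → ℂ) :
    normSq (M *ᵥ v) ≤ ‖M‖ ^ 2 * normSq v := by
  rw [normSq_eq_norm_sq, normSq_eq_norm_sq, ← mul_pow]
  gcongr
  exact l2_opNorm_mulVec M (WithLp.toLp 2 v)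

theorem norm_le_of_normSq_le [DecidableEq n] {M : Matrix m n ℂ} {c : ℝ} (hc : 0 ≤ c)
    (h : ∀ v, normSq (M *ᵥ v) ≤ c ^ 2 * normSq v) : ‖M‖ ≤ c := by
  rw [l2_opNorm_def]
  refine ContinuousLinearMap.opNorm_le_bound _ hc fun x => ?_
  have := h x.ofLp
  rw [normSq_eq_norm_sq, normSq_eq_norm_sq, ← mul_pow] at this
  exact le_of_sq_le_sq this (by positivity)

theorem norm_sq_le_singularValues_zero {E F : Type*} [NormedAddCommGroup E]
    [InnerProductSpace ℂ E] [FiniteDimensional ℂ E] [NormedAddCommGroup F]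
    [InnerProductSpace ℂ F] [FiniteDimensional ℂ F] (T : E →ₗ[ℂ] F) (x : E) :
    ‖T x‖ ^ 2 ≤ T.singularValues 0 ^ 2 * ‖x‖ ^ 2 := by
  have hS := T.isSymmetric_adjoint_comp_self
  set b := hS.eigenvectorBasis rfl with hb
  have h1 : ((‖T x‖ ^ 2 : ℝ) : ℂ) =
      ∑ i, ((hS.eigenvalues rfl i * ‖inner ℂ (b i) x‖ ^ 2 : ℝ) : ℂ) := by
    have : ((‖T x‖ ^ 2 : ℝ) : ℂ) = inner ℂ ((LinearMap.adjoint T ∘ₗ T) x) x := by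
      rw [LinearMap.comp_apply, LinearMap.adjoint_inner_left, inner_self_eq_norm_sq_to_K]
      norm_cast
    rw [this, ← b.sum_inner_mul_inner]
    refine Finset.sum_congr rfl fun i _ => ?_
    rw [hS x (b i), hb, hS.apply_eigenvectorBasis, inner_smul_right, mul_assoc,
      ← inner_conj_symm x, Complex.conj_mul']
    push_cast
    rfl
  have h2 : ‖T x‖ ^ 2 = ∑ i, hS.eigenvalues rfl i * ‖inner ℂ (b i) x‖ ^ 2 := by
    exact_mod_cast h1
  rw [h2, ← b.sum_sq_norm_inner_right x, Finset.mul_sum]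
  refine Finset.sum_le_sum fun i _ => ?_
  gcongr
  rw [← T.sq_singularValues_fin rfl i]
  have := T.singularValues_antitone (Nat.zero_le i)
  have h0 := T.singularValues_nonneg i
  gcongr

theorem singularValues_zero_le {E F : Type*} [NormedAddCommGroup E]
    [InnerProductSpace ℂ E] [FiniteDimensional ℂ E] [NormedAddCommGroup F]
    [InnerProductSpace ℂ F] [FiniteDimensional ℂ F] (T : E →ₗ[ℂ] F) {c : ℝ} (hc : 0 ≤ c)
    (h : ∀ x, ‖T x‖ ≤ c * ‖x‖) : T.singularValues 0 ≤ c := by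
  rcases Nat.eq_zero_or_pos (Module.finrank ℂ E) with h0 | h0
  · rw [T.singularValues_of_finrank_le h0.le]
    exact hc
  · obtain ⟨v, hv⟩ :=
      (T.hasEigenvalue_adjoint_comp_self_sq_singularValues h0).exists_hasEigenvector
    have hv0 : 0 < ‖v‖ := norm_pos_iff.2 hv.2
    have h1 : ‖T v‖ ^ 2 = T.singularValues 0 ^ 2 * ‖v‖ ^ 2 := by
      have h2 : ((‖T v‖ ^ 2 : ℝ) : ℂ) = inner ℂ v ((LinearMap.adjoint T ∘ₗ T) v) := by
        rw [LinearMap.comp_apply, LinearMap.adjoint_inner_right, inner_self_eq_norm_sq_to_K]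
        norm_cast
      rw [hv.apply_eq_smul, inner_smul_right, inner_self_eq_norm_sq_to_K] at h2
      refine Complex.ofReal_injective (h2.trans ?_)
      push_cast
      rfl
    have h2 : T.singularValues 0 ^ 2 * ‖v‖ ^ 2 ≤ c ^ 2 * ‖v‖ ^ 2 := by
      rw [← h1, ← mul_pow]
      gcongr
      exact h v
    exact le_of_sq_le_sq (le_of_mul_le_mul_right h2 (by positivity)) hc

theorem sigmaMax_eq_norm [DecidableEq n] (M : Matrix m n ℂ) : sigmaMax M = ‖M‖ := by
  refine le_antisymm (singularValues_zero_le _ (norm_nonneg _) fun x => ?_)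
    (norm_le_of_normSq_le (LinearMap.singularValues_nonneg _ _) fun v => ?_)
  · exact l2_opNorm_mulVec M x
  · rw [normSq_eq_norm_sq, normSq_eq_norm_sq]
    exact norm_sq_le_singularValues_zero (Matrix.toEuclideanLin M) (WithLp.toLp 2 v)

omit [Fintype m] in
theorem re_toComplex_mulVec (M : Matrix m n ℝ) (v : n → ℂ) (i : m) :
    ((toComplex M *ᵥ v) i).re = (M *ᵥ fun j => (v j).re) i := by
  simp [toComplex, mulVec, dotProduct]

omit [Fintype m] in
theorem im_toComplex_mulVec (M : Matrix m n ℝ) (v : n → ℂ) (i : m) :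
    ((toComplex M *ᵥ v) i).im = (M *ᵥ fun j => (v j).im) i := by
  simp [toComplex, mulVec, dotProduct]

theorem normSq_eq_re_add_im (v : n → ℂ) : normSq v =
    (fun j => (v j).re) ⬝ᵥ (fun j => (v j).re) + (fun j => (v j).im) ⬝ᵥ (fun j => (v j).im) := by
  simp only [normSq, dotProduct, ← Finset.sum_add_distrib, Complex.sq_norm, Complex.normSq_apply]

/-- The storage function extended to complex vectors; it is invariant under rotations. -/
def complexStorage (X : Matrix n n ℝ) (v : n → ℂ) : ℝ :=
  (fun j => (v j).re) ⬝ᵥ X *ᵥ (fun j => (v j).re) + (fun j => (v j).im) ⬝ᵥ X *ᵥ (fun j => (v j).im)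

theorem complexStorage_smul (X : Matrix n n ℝ) (z : ℂ) (v : n → ℂ) :
    complexStorage X (z • v) = ‖z‖ ^ 2 * complexStorage X v := by
  have hr : (fun j => ((z • v) j).re) = z.re • (fun j => (v j).re) - z.im • fun j => (v j).im := by
    ext j; simp
  have hi : (fun j => ((z • v) j).im) = z.re • (fun j => (v j).im) + z.im • fun j => (v j).re := by
    ext j; simp
  rw [complexStorage, complexStorage, hr, hi, Complex.sq_norm, Complex.normSq_apply]
  simp only [mulVec_add, mulVec_sub, mulVec_smul, dotProduct_add, dotProduct_sub, add_dotProduct,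
    sub_dotProduct, dotProduct_smul, smul_dotProduct, smul_eq_mul]
  ring

theorem Dissipative.complex {F : Matrix n n ℝ} {G : Matrix n m ℝ} {H : Matrix l n ℝ}
    {X : Matrix n n ℝ} {g : ℝ} (h : Dissipative F G H X g) (x : n → ℂ) (y : m → ℂ) :
    complexStorage X (toComplex F *ᵥ x + toComplex G *ᵥ y) + normSq (toComplex H *ᵥ x) ≤
      complexStorage X x + g * normSq y := by
  have h1 := h (fun j => (x j).re) (fun j => (y j).re)
  have h2 := h (fun j => (x j).im) (fun j => (y j).im)
  simp only [complexStorage, normSq_eq_re_add_im, Pi.add_apply, Complex.add_re, Complex.add_im,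
    re_toComplex_mulVec, im_toComplex_mulVec]
  have e1 : (fun j => (F *ᵥ fun j => (x j).re) j + (G *ᵥ fun j => (y j).re) j) =
    F *ᵥ (fun j => (x j).re) + G *ᵥ (fun j => (y j).re) := rfl
  have e2 : (fun j => (F *ᵥ fun j => (x j).im) j + (G *ᵥ fun j => (y j).im) j) =
    F *ᵥ (fun j => (x j).im) + G *ᵥ (fun j => (y j).im) := rfl
  rw [e1, e2]
  linarith

/-- The sufficiency part of the bounded real lemma, at a single frequency. -/
theorem Dissipative.frequency_bound {F : Matrix n n ℝ} {G : Matrix n m ℝ} {H : Matrix l n ℝ}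
    {X : Matrix n n ℝ} {g : ℝ} (h : Dissipative F G H X g) {z : ℂ} (hz : ‖z‖ = 1) {x : n → ℂ}
    {y : m → ℂ} (hxy : z • x = toComplex F *ᵥ x + toComplex G *ᵥ y) :
    normSq (toComplex H *ᵥ x) ≤ g * normSq y := by
  have := h.complex x y
  rw [← hxy, complexStorage_smul, hz] at this
  linarith

end Norms

/-! ### Schur stability -/

section Stability

theorem SchurStable.det_ne_zero {n : ℕ} {M : Matrix (Fin n) (Fin n) ℝ} (hM : SchurStable M)
    {z : ℂ} (hz : 1 ≤ ‖z‖) : (z • (1 : Matrix (Fin n) (Fin n) ℂ) - toComplex M).det ≠ 0 := by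
  have h : z ∈ resolventSet ℂ (toComplex M) := by
    refine spectrum.mem_resolventSet_of_spectralRadius_lt (hM.trans_le ?_)
    exact_mod_cast hz
  rw [spectrum.mem_resolventSet_iff, Matrix.isUnit_iff_isUnit_det, Algebra.algebraMap_eq_smul_one]
    at h
  exact h.ne_zero

theorem toComplex_pow {n : ℕ} (M : Matrix (Fin n) (Fin n) ℝ) (k : ℕ) :
    toComplex (M ^ k) = toComplex M ^ k :=
  Matrix.map_pow (f := Complex.ofRealHom) M k

/-- By Gelfand's formula, the powers of a Schur stable matrix tend to zero. -/
theorem SchurStable.tendsto_transpose_pow_mulVec {n : ℕ} {M : Matrix (Fin n) (Fin n) ℝ}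
    (hM : SchurStable M) (x : Fin n → ℝ) :
    Tendsto (fun k : ℕ => (Mᵀ ^ k) *ᵥ x) atTop (𝓝 0) := by
  obtain ⟨r, hr, hr1⟩ := exists_between hM
  have hpow : Tendsto (fun k : ℕ => toComplex M ^ k) atTop (𝓝 0) := by
    rw [tendsto_zero_iff_norm_tendsto_zero]
    have hev := (spectrum.pow_nnnorm_pow_one_div_tendsto_nhds_spectralRadius
      (toComplex M)).eventually_lt_const hr
    lift r to NNReal using ne_top_of_lt hr1
    refine squeeze_zero' (Eventually.of_forall fun k => norm_nonneg _) ?_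
      (tendsto_pow_atTop_nhds_zero_of_lt_one r.2 (by exact_mod_cast hr1 : (r : ℝ) < 1))
    filter_upwards [hev, eventually_gt_atTop 0] with k hk hk0
    have hk' : (0 : ℝ) < k := by exact_mod_cast hk0
    have := (ENNReal.rpow_lt_rpow hk hk').le
    rw [← ENNReal.rpow_mul, one_div_mul_cancel hk'.ne', ENNReal.rpow_one, ENNReal.rpow_natCast]
      at this
    exact_mod_cast this
  have hentry : ∀ i j, Tendsto (fun k : ℕ => (M ^ k) i j) atTop (𝓝 0) := by
    intro i j
    have h1 : Tendsto (fun k : ℕ => (toComplex M ^ k) i j) atTop (𝓝 0) :=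
      tendsto_pi_nhds.1 (tendsto_pi_nhds.1 hpow i) j
    have h2 := (Complex.continuous_re.tendsto 0).comp h1
    refine h2.congr fun k => ?_
    rw [Function.comp_apply, ← toComplex_pow]
    simp [toComplex]
  rw [tendsto_pi_nhds]
  intro i
  simp only [← transpose_pow, mulVec, dotProduct, transpose_apply, Pi.zero_apply]
  simpa using tendsto_finsetSum Finset.univ fun j _ => (hentry j i).mul_const (x j)

/-- The Lyapunov criterion, for the transpose of the system matrix. -/
theorem Dissipative.schurStable {n : ℕ} {m l : Type*} [Fintype m] [Fintype l]
    {M : Matrix (Fin n) (Fin n) ℝ} {G : Matrix (Fin n) m ℝ} {H : Matrix l (Fin n) ℝ}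
    {X : Matrix (Fin n) (Fin n) ℝ} {g : ℝ} (h : Dissipative Mᵀ G H X g)
    (hX : ∀ x, 0 ≤ x ⬝ᵥ X *ᵥ x) (hH : ∀ x : Fin n → ℂ, x ≠ 0 → 0 < normSq (toComplex H *ᵥ x)) :
    SchurStable M := by
  rw [SchurStable]
  rcases (spectrum ℂ (toComplex M)).eq_empty_or_nonempty with he | hne
  · simp [spectralRadius, he]
  · have key : ∀ k ∈ spectrum ℂ (toComplex M), ‖k‖₊ < 1 := by
      intro k hk
      rw [spectrum.mem_iff, Matrix.isUnit_iff_isUnit_det, isUnit_iff_ne_zero, not_not,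
        ← det_transpose, ← exists_mulVec_eq_zero_iff] at hk
      obtain ⟨v, hv, hkv⟩ := hk
      have hkv' : toComplex Mᵀ *ᵥ v = k • v := by
        rw [Algebra.algebraMap_eq_smul_one, transpose_sub, sub_mulVec, sub_eq_zero,
          transpose_smul, transpose_one, smul_mulVec, one_mulVec] at hkv
        exact hkv.symm
      have h1 := h.complex v 0
      have h2 := hH v hv
      have h3 : 0 ≤ complexStorage X v := add_nonneg (hX _) (hX _)
      simp only [mulVec_zero, add_zero, hkv', complexStorage_smul] at h1
      have h4 : normSq (0 : m → ℂ) = 0 := by simp [normSq]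
      rw [h4] at h1
      by_contra! hcon
      have hk1 : (1 : ℝ) ≤ ‖k‖ := by exact_mod_cast hcon
      have : 1 ≤ ‖k‖ ^ 2 := one_le_pow₀ hk1
      nlinarith
    exact_mod_cast spectrum.spectralRadius_lt_of_forall_lt_of_nonempty hne key

end Stability

/-! ### The closed loop -/

/-- The data of the state feedback problem, with arbitrary square roots `Sq`, `Sr` of the
weights. -/
structure Plant (nx nu nw : ℕ) where
  /-- The state matrix. -/
  A : Matrix (Fin nx) (Fin nx) ℝ
  /-- The control input matrix. -/
  B : Matrix (Fin nx) (Fin nu) ℝ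
  /-- The disturbance input matrix. -/
  Bw : Matrix (Fin nx) (Fin nw) ℝ
  /-- The square root of the state weight. -/
  Sq : Matrix (Fin nx) (Fin nx) ℝ
  /-- The square root of the input weight. -/
  Sr : Matrix (Fin nu) (Fin nu) ℝ

namespace Plant

variable {nx nu nw : ℕ} (P : Plant nx nu nw)

/-- The closed-loop state matrix. -/
def closedLoop (K : Matrix (Fin nu) (Fin nx) ℝ) : Matrix (Fin nx) (Fin nx) ℝ := P.A + P.B * K

/-- The closed-loop output matrix. -/
def output (K : Matrix (Fin nu) (Fin nx) ℝ) : Matrix (Fin nx ⊕ Fin nu) (Fin nx) ℝ :=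
  fromRows P.Sq (P.Sr * K)

/-- The matrix `z I - (A + B K)`. -/
def pencil (K : Matrix (Fin nu) (Fin nx) ℝ) (z : ℂ) : Matrix (Fin nx) (Fin nx) ℂ :=
  z • (1 : Matrix (Fin nx) (Fin nx) ℂ) - toComplex (P.closedLoop K)

/-- The closed-loop transfer matrix. -/
def transfer (K : Matrix (Fin nu) (Fin nx) ℝ) (z : ℂ) : Matrix (Fin nx ⊕ Fin nu) (Fin nw) ℂ :=
  toComplex (P.output K) * (P.pencil K z)⁻¹ * toComplex P.Bw

/-- The closed-loop `H∞` norm. -/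
def hinf (K : Matrix (Fin nu) (Fin nx) ℝ) : ℝ :=
  sSup ((fun ω : ℝ => ‖P.transfer K (Complex.exp (Complex.I * ω))‖) '' Set.Icc 0 (2 * Real.pi))

/-- The closed-loop matrix has no eigenvalue on the unit circle. -/
def Regular (K : Matrix (Fin nu) (Fin nx) ℝ) : Prop :=
  ∀ z : ℂ, ‖z‖ = 1 → (P.pencil K z).det ≠ 0

/-- `X` is a storage matrix certifying the bound `g` on the square of the `H∞` norm. The
dissipation inequality is that of the dual closed loop, as this is the one that becomes convex in
`(X, K X, g)`. -/
def Certificate (K : Matrix (Fin nu) (Fin nx) ℝ) (X : Matrix (Fin nx) (Fin nx) ℝ) (g : ℝ) : Prop :=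
  Dissipative (P.closedLoop K)ᵀ (P.output K)ᵀ P.Bwᵀ X g

variable {P} {K : Matrix (Fin nu) (Fin nx) ℝ}

theorem norm_exp_I_mul (ω : ℝ) : ‖Complex.exp (Complex.I * ω)‖ = 1 := by
  rw [mul_comm, Complex.norm_exp_ofReal_mul_I]

theorem exists_angle {z : ℂ} (hz : ‖z‖ = 1) :
    ∃ ω ∈ Set.Icc (0 : ℝ) (2 * Real.pi), Complex.exp (Complex.I * ω) = z := by
  have h : Complex.exp (Complex.I * z.arg) = z := by
    have := Complex.norm_mul_exp_arg_mul_I z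
    rwa [hz, Complex.ofReal_one, one_mul, mul_comm] at this
  have h1 := Complex.neg_pi_lt_arg z
  have h2 := Complex.arg_le_pi z
  have hp := Real.pi_pos
  rcases le_total 0 z.arg with h0 | h0
  · exact ⟨z.arg, ⟨h0, by linarith⟩, h⟩
  · refine ⟨z.arg + 2 * Real.pi, ⟨by linarith, by linarith⟩, ?_⟩
    push_cast
    rw [mul_add, Complex.exp_add, mul_comm Complex.I (2 * _), Complex.exp_two_pi_mul_I, mul_one, h]

theorem _root_.ContinuousAt.matrix_inv {𝕜 α k : Type*} [RCLike 𝕜] [TopologicalSpace α] [Fintype k]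
    [DecidableEq k] {f : α → Matrix k k 𝕜} {a : α} (hf : ContinuousAt f a) (ha : (f a).det ≠ 0) :
    ContinuousAt (fun x => (f x)⁻¹) a := by
  simp only [Matrix.inv_def, Ring.inverse_eq_inv']
  have hdet : ContinuousAt (fun x => (f x).det) a :=
    (Continuous.matrix_det continuous_id).continuousAt.comp hf
  have hadj : ContinuousAt (fun x => (f x).adjugate) a :=
    (Continuous.matrix_adjugate continuous_id).continuousAt.comp hf
  exact (hdet.inv₀ ha).smul hadj

theorem Regular.continuous_inv_pencil (hK : P.Regular K) :
    Continuous fun ω : ℝ => (P.pencil K (Complex.exp (Complex.I * ω)))⁻¹ := by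
  refine continuous_iff_continuousAt.2 fun ω => ContinuousAt.matrix_inv ?_
    (hK _ (norm_exp_I_mul ω))
  unfold pencil
  fun_prop

theorem Regular.continuous_transfer (hK : P.Regular K) :
    Continuous fun ω : ℝ => P.transfer K (Complex.exp (Complex.I * ω)) := by
  unfold transfer
  exact (continuous_const.matrix_mul hK.continuous_inv_pencil).matrix_mul continuous_const

theorem nonempty_Icc_two_pi : (Set.Icc (0 : ℝ) (2 * Real.pi)).Nonempty :=
  Set.nonempty_Icc.2 (by positivity)

theorem Regular.exists_hinf_eq (hK : P.Regular K) :
    ∃ z : ℂ, ‖z‖ = 1 ∧ P.hinf K = ‖P.transfer K z‖ := by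
  obtain ⟨ω, _, h⟩ := isCompact_Icc.exists_sSup_image_eq nonempty_Icc_two_pi
    hK.continuous_transfer.norm.continuousOn
  exact ⟨_, norm_exp_I_mul ω, h⟩

theorem Regular.norm_transfer_le_hinf (hK : P.Regular K) {z : ℂ} (hz : ‖z‖ = 1) :
    ‖P.transfer K z‖ ≤ P.hinf K := by
  obtain ⟨ω, hω, rfl⟩ := exists_angle hz
  exact le_csSup (isCompact_Icc.bddAbove_image hK.continuous_transfer.norm.continuousOn)
    ⟨ω, hω, rfl⟩

theorem hinf_le {c : ℝ} (h : ∀ z : ℂ, ‖z‖ = 1 → ‖P.transfer K z‖ ≤ c) : P.hinf K ≤ c := by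
  refine csSup_le (nonempty_Icc_two_pi.image _) ?_
  rintro _ ⟨ω, _, rfl⟩
  exact h _ (norm_exp_I_mul ω)

theorem hinf_nonneg : 0 ≤ P.hinf K := by
  refine Real.sSup_nonneg ?_
  rintro _ ⟨ω, _, rfl⟩
  exact norm_nonneg _

theorem regular_of_schurStable (hK : SchurStable (P.closedLoop K)) : P.Regular K :=
  fun _ hz => hK.det_ne_zero hz.ge

theorem conjTranspose_toComplex {k l : Type*} (M : Matrix k l ℝ) :
    (toComplex M)ᴴ = toComplex Mᵀ := by
  ext i j
  simp [toComplex]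

theorem conjTranspose_pencil (z : ℂ) : (P.pencil K z)ᴴ =
    (starRingEnd ℂ z) • (1 : Matrix (Fin nx) (Fin nx) ℂ) - toComplex (P.closedLoop K)ᵀ := by
  rw [pencil, conjTranspose_sub, conjTranspose_smul, conjTranspose_one, conjTranspose_toComplex]
  rfl

/-- The stationary state of the dual closed loop at the frequency `conj z`, in terms of the
resolvent of the closed loop at `z`. -/
theorem dual_stationary_iff {z : ℂ} (hz : (P.pencil K z).det ≠ 0) {x : Fin nx → ℂ}
    {y : Fin nx ⊕ Fin nu → ℂ} : (starRingEnd ℂ z) • x =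
        toComplex (P.closedLoop K)ᵀ *ᵥ x + toComplex (P.output K)ᵀ *ᵥ y ↔
      x = ((P.pencil K z)⁻¹)ᴴ *ᵥ (toComplex (P.output K)ᵀ *ᵥ y) := by
  have hu : IsUnit ((P.pencil K z)ᴴ).det := by
    rw [det_conjTranspose]
    exact (isUnit_iff_ne_zero.2 hz).star
  rw [conjTranspose_nonsing_inv]
  have h1 : (starRingEnd ℂ z) • x =
      toComplex (P.closedLoop K)ᵀ *ᵥ x + toComplex (P.output K)ᵀ *ᵥ y ↔
      (P.pencil K z)ᴴ *ᵥ x = toComplex (P.output K)ᵀ *ᵥ y := by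
    rw [conjTranspose_pencil, sub_mulVec, smul_mulVec, one_mulVec, sub_eq_iff_eq_add']
  rw [h1]
  constructor
  · intro h
    rw [← h, mulVec_mulVec, nonsing_inv_mul _ hu, one_mulVec]
  · intro h
    rw [h, mulVec_mulVec, mul_nonsing_inv _ hu, one_mulVec]

/-- The conjugate transpose of the transfer matrix is the transfer matrix of the dual system. -/
theorem conjTranspose_transfer (z : ℂ) : (P.transfer K z)ᴴ =
    toComplex P.Bwᵀ * ((P.pencil K z)⁻¹)ᴴ * toComplex (P.output K)ᵀ := by
  rw [transfer, conjTranspose_mul, conjTranspose_mul, conjTranspose_toComplex,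
    conjTranspose_toComplex, Matrix.mul_assoc]

theorem Certificate.norm_transfer_le {X : Matrix (Fin nx) (Fin nx) ℝ} {g : ℝ}
    (h : P.Certificate K X (g ^ 2)) (hg : 0 ≤ g) {z : ℂ} (hz : ‖z‖ = 1)
    (hdet : (P.pencil K z).det ≠ 0) : ‖P.transfer K z‖ ≤ g := by
  rw [← l2_opNorm_conjTranspose]
  refine norm_le_of_normSq_le hg fun y => ?_
  rw [conjTranspose_transfer, ← mulVec_mulVec, ← mulVec_mulVec]
  exact Dissipative.frequency_bound h (z := starRingEnd ℂ z) (by simpa using hz)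
    ((dual_stationary_iff hdet).2 rfl)

theorem Certificate.hinf_le {X : Matrix (Fin nx) (Fin nx) ℝ} {g : ℝ}
    (h : P.Certificate K X (g ^ 2)) (hg : 0 ≤ g) (hK : P.Regular K) : P.hinf K ≤ g :=
  Plant.hinf_le fun z hz => h.norm_transfer_le hg hz (hK z hz)

/-- The bounded real lemma for the dual closed loop, whose input matrix `(P.output K)ᵀ` is
surjective because `P.Sq` is invertible. -/
theorem exists_certificate (hSq : P.Sq.det ≠ 0) (hK : SchurStable (P.closedLoop K)) {g : ℝ}
    (hg : P.hinf K ≤ g) : ∃ X : Matrix (Fin nx) (Fin nx) ℝ, Xᵀ = X ∧ (∀ x, 0 ≤ x ⬝ᵥ X *ᵥ x) ∧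
      P.Certificate K X (g ^ 2) := by
  have hreg := regular_of_schurStable hK
  refine exists_dissipative (fromRows P.Sqᵀ⁻¹ (0 : Matrix (Fin nu) (Fin nx) ℝ)) ?_
    hK.tendsto_transpose_pow_mulVec ?_
  · rw [output, transpose_fromRows, fromCols_mul_fromRows, Matrix.mul_zero, add_zero,
      mul_nonsing_inv]
    rw [det_transpose]
    exact isUnit_iff_ne_zero.2 hSq
  · intro z hz x y hxy
    have hz' : ‖starRingEnd ℂ z‖ = 1 := by simpa using hz
    rw [← Complex.conj_conj z, dual_stationary_iff (hreg _ hz')] at hxy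
    rw [hxy, mulVec_mulVec, mulVec_mulVec, ← conjTranspose_transfer]
    refine (normSq_mulVec_le _ _).trans ?_
    have := normSq_nonneg y
    gcongr
    rw [l2_opNorm_conjTranspose]
    exact (hreg.norm_transfer_le_hinf hz').trans hg

end Plant

/-! ### Compactness of the set of certificates and existence of an optimal gain -/

theorem mulVec_dotProduct_self_le {k l : Type*} [Fintype k] [Fintype l] (M : Matrix k l ℝ)
    (v : l → ℝ) : (M *ᵥ v) ⬝ᵥ (M *ᵥ v) ≤ (∑ i, ∑ j, M i j ^ 2) * (v ⬝ᵥ v) := by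
  rw [dotProduct, Finset.sum_mul]
  refine Finset.sum_le_sum fun i _ => ?_
  have := Finset.sum_mul_sq_le_sq_mul_sq Finset.univ (M i) v
  simpa only [mulVec, dotProduct, ← sq] using this

theorem zero_le_dotProduct_self {k : Type*} [Fintype k] (v : k → ℝ) : 0 ≤ v ⬝ᵥ v :=
  Finset.sum_nonneg fun i _ => mul_self_nonneg (v i)

theorem dotProduct_self_pos {k : Type*} [Fintype k] {v : k → ℝ} (hv : v ≠ 0) : 0 < v ⬝ᵥ v :=
  lt_of_le_of_ne (zero_le_dotProduct_self v) fun h => hv (dotProduct_self_eq_zero.1 h.symm)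

/-- A matrix of full row rank has a transpose that is bounded below. -/
theorem exists_pos_le_transpose_mulVec {n m : ℕ} {M : Matrix (Fin n) (Fin m) ℝ}
    (hM : M.rank = n) : ∃ β : ℝ, 0 < β ∧ ∀ x, β * (x ⬝ᵥ x) ≤ (Mᵀ *ᵥ x) ⬝ᵥ (Mᵀ *ᵥ x) := by
  have hsurj : Function.Surjective M.mulVec := by
    have : LinearMap.range M.mulVecLin = ⊤ := by
      apply Submodule.eq_top_of_finrank_eq
      rw [← Matrix.rank, hM]
      simp
    exact LinearMap.range_eq_top.1 this
  obtain ⟨E, hE⟩ := mulVec_surjective_iff_exists_right_inverse.1 hsurj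
  set c : ℝ := ∑ i, ∑ j, Eᵀ i j ^ 2 with hc
  have hc0 : 0 ≤ c := Finset.sum_nonneg fun i _ => Finset.sum_nonneg fun j _ => sq_nonneg _
  refine ⟨1 / (c + 1), by positivity, fun x => ?_⟩
  have h1 := mulVec_dotProduct_self_le Eᵀ (Mᵀ *ᵥ x)
  rw [mulVec_mulVec, ← transpose_mul, hE, transpose_one, one_mulVec, ← hc] at h1
  have h2 := zero_le_dotProduct_self (Mᵀ *ᵥ x)
  rw [div_mul_eq_mul_div, one_mul, div_le_iff₀ (by positivity)]
  linarith

/-- A positive semidefinite quadratic form bounded above has bounded entries. -/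
theorem abs_apply_le_of_quadratic_bound {k : Type*} [Fintype k] [DecidableEq k]
    {X : Matrix k k ℝ} {c : ℝ} (hX : Xᵀ = X) (h0 : ∀ x, 0 ≤ x ⬝ᵥ X *ᵥ x)
    (hc : ∀ x, x ⬝ᵥ X *ᵥ x ≤ c * (x ⬝ᵥ x)) (i j : k) : |X i j| ≤ c := by
  have hsymm : X j i = X i j := congrFun (congrFun hX i) j
  have h1 := h0 (Pi.single i 1 - Pi.single j 1)
  have h2 := h0 (Pi.single i 1 + Pi.single j 1)
  have h3 := hc (Pi.single i 1)
  have h4 := hc (Pi.single j 1)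
  simp only [mulVec_add, mulVec_sub, add_dotProduct, sub_dotProduct, dotProduct_add,
    dotProduct_sub, mulVec_single_one, single_one_dotProduct, col_apply, Pi.single_eq_same,
    hsymm] at h1 h2 h3 h4
  rw [abs_le]
  constructor <;> linarith

namespace Plant

variable {nx nu nw : ℕ} {P : Plant nx nu nw} {K : Matrix (Fin nu) (Fin nx) ℝ}
  {X : Matrix (Fin nx) (Fin nx) ℝ} {g β : ℝ}

/-- The state update of the dual closed loop depends affinely on `Kᵀ`. -/
theorem dual_step (P : Plant nx nu nw) (K : Matrix (Fin nu) (Fin nx) ℝ) (x : Fin nx → ℝ)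
    (y : Fin nx ⊕ Fin nu → ℝ) :
    (P.closedLoop K)ᵀ *ᵥ x + (P.output K)ᵀ *ᵥ y =
      (P.Aᵀ *ᵥ x + P.Sqᵀ *ᵥ (y ∘ Sum.inl)) + Kᵀ *ᵥ (P.Bᵀ *ᵥ x + P.Srᵀ *ᵥ (y ∘ Sum.inr)) := by
  rw [closedLoop, output, transpose_fromRows, fromCols_mulVec, transpose_add, transpose_mul,
    transpose_mul, add_mulVec, mulVec_add, mulVec_mulVec, mulVec_mulVec]
  abel

/-- Storage matrices are bounded below, since the disturbance enters every state. -/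
theorem Certificate.le_storage (h : P.Certificate K X g) (hX : ∀ x, 0 ≤ x ⬝ᵥ X *ᵥ x)
    (hβ : ∀ x, β * (x ⬝ᵥ x) ≤ (P.Bwᵀ *ᵥ x) ⬝ᵥ (P.Bwᵀ *ᵥ x)) (x : Fin nx → ℝ) :
    β * (x ⬝ᵥ x) ≤ x ⬝ᵥ X *ᵥ x := by
  have h1 := h x 0
  have h2 := hX ((P.closedLoop K)ᵀ *ᵥ x)
  simp only [mulVec_zero, add_zero, dotProduct_zero, mul_zero] at h1
  linarith [hβ x]

/-- Storage matrices are bounded above, since every state of the dual system is reached from the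
origin in one step. -/
theorem Certificate.storage_le (h : P.Certificate K X g) (hSq : P.Sq.det ≠ 0) (hg : 0 ≤ g)
    (x : Fin nx → ℝ) : x ⬝ᵥ X *ᵥ x ≤ g * (∑ i, ∑ j, (P.Sqᵀ⁻¹) i j ^ 2) * (x ⬝ᵥ x) := by
  have hu : IsUnit P.Sqᵀ.det := by rw [det_transpose]; exact isUnit_iff_ne_zero.2 hSq
  have h1 := h 0 (Sum.elim (P.Sqᵀ⁻¹ *ᵥ x) 0)
  rw [dual_step] at h1
  simp only [mulVec_zero, Sum.elim_comp_inl, Sum.elim_comp_inr, mulVec_mulVec,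
    mul_nonsing_inv _ hu, one_mulVec, add_zero, zero_add,
    sumElim_dotProduct_sumElim, dotProduct_zero] at h1
  refine h1.trans ?_
  rw [mul_assoc]
  gcongr
  exact mulVec_dotProduct_self_le _ _

/-- The certified bound on the weighted input, combined with the lower bound on the storage matrix,
bounds the gain. -/
theorem Certificate.gain_le (h : P.Certificate K X g) (hX : ∀ x, 0 ≤ x ⬝ᵥ X *ᵥ x)
    (hβ0 : 0 < β) (hβ : ∀ x, β * (x ⬝ᵥ x) ≤ (P.Bwᵀ *ᵥ x) ⬝ᵥ (P.Bwᵀ *ᵥ x))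
    (hSr : P.Sr.det ≠ 0) (hg : 0 ≤ g) (i : Fin nu) (j : Fin nx) :
    K i j ^ 2 ≤ g * (∑ i, ∑ j, (P.Srᵀ⁻¹) i j ^ 2) / β := by
  have hu : IsUnit P.Srᵀ.det := by rw [det_transpose]; exact isUnit_iff_ne_zero.2 hSr
  have h1 := h 0 (Sum.elim 0 (P.Srᵀ⁻¹ *ᵥ Pi.single i 1))
  rw [dual_step] at h1
  simp only [mulVec_zero, Sum.elim_comp_inl, Sum.elim_comp_inr, mulVec_mulVec,
    mul_nonsing_inv _ hu, one_mulVec, add_zero, zero_add,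
    sumElim_dotProduct_sumElim, dotProduct_zero] at h1
  rw [← mulVec_mulVec] at h1
  have h2 := h.le_storage hX hβ (Kᵀ *ᵥ Pi.single i 1)
  have h3 := mulVec_dotProduct_self_le P.Srᵀ⁻¹ (Pi.single i 1)
  have h4 : (Pi.single i 1 : Fin nu → ℝ) ⬝ᵥ Pi.single i 1 = 1 := by simp
  have h5 : K i j ^ 2 ≤ (Kᵀ *ᵥ Pi.single i 1) ⬝ᵥ (Kᵀ *ᵥ Pi.single i 1) := by
    rw [mulVec_single_one, dotProduct]
    simp only [col_apply, transpose_apply, ← sq]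
    exact Finset.single_le_sum (f := fun j => K i j ^ 2) (fun _ _ => sq_nonneg _)
      (Finset.mem_univ j)
  rw [h4, mul_one] at h3
  have h6 := mul_le_mul_of_nonneg_left h3 hg
  have h7 := mul_le_mul_of_nonneg_left h5 hβ0.le
  rw [le_div_iff₀ hβ0]
  linarith

theorem Certificate.schurStable (h : P.Certificate K X g) (hX : ∀ x, 0 ≤ x ⬝ᵥ X *ᵥ x)
    (hβ0 : 0 < β) (hβ : ∀ x, β * (x ⬝ᵥ x) ≤ (P.Bwᵀ *ᵥ x) ⬝ᵥ (P.Bwᵀ *ᵥ x)) :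
    SchurStable (P.closedLoop K) := by
  refine Dissipative.schurStable h hX fun x hx => ?_
  have h1 := hβ (fun j => (x j).re)
  have h2 := hβ (fun j => (x j).im)
  have h3 : 0 < β * normSq x := mul_pos hβ0 (normSq_pos hx)
  rw [normSq_eq_re_add_im] at h3 ⊢
  simp only [re_toComplex_mulVec, im_toComplex_mulVec]
  linarith

/-- The triples of a level `γ ∈ [0, c]`, a gain `K` and a positive semidefinite storage matrix
certifying that the `H∞` norm at `K` is at most `γ`. -/
def certificates (P : Plant nx nu nw) (c : ℝ) :
    Set (ℝ × Matrix (Fin nu) (Fin nx) ℝ × Matrix (Fin nx) (Fin nx) ℝ) :=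
  {p | p.1 ∈ Set.Icc 0 c ∧ p.2.2ᵀ = p.2.2 ∧ (∀ x, 0 ≤ x ⬝ᵥ p.2.2 *ᵥ x) ∧
    P.Certificate p.2.1 p.2.2 (p.1 ^ 2)}

theorem isClosed_certificates (P : Plant nx nu nw) (c : ℝ) :
    IsClosed (P.certificates c) := by
  have h1 : IsClosed {p : ℝ × Matrix (Fin nu) (Fin nx) ℝ × Matrix (Fin nx) (Fin nx) ℝ |
      p.2.2ᵀ = p.2.2} := isClosed_eq (by fun_prop) (by fun_prop)
  have h2 : IsClosed {p : ℝ × Matrix (Fin nu) (Fin nx) ℝ × Matrix (Fin nx) (Fin nx) ℝ |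
      ∀ x, 0 ≤ x ⬝ᵥ p.2.2 *ᵥ x} := by
    rw [Set.ofPred_forall]
    exact isClosed_iInter fun x => isClosed_le continuous_const (by fun_prop)
  have h3 : IsClosed {p : ℝ × Matrix (Fin nu) (Fin nx) ℝ × Matrix (Fin nx) (Fin nx) ℝ |
      P.Certificate p.2.1 p.2.2 (p.1 ^ 2)} := by
    simp only [Certificate, Dissipative, dual_step, Set.ofPred_forall]
    exact isClosed_iInter fun x => isClosed_iInter fun y =>
      isClosed_le (by fun_prop) (by fun_prop)
  exact (isClosed_Icc.preimage continuous_fst).inter (h1.inter (h2.inter h3))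

theorem isCompact_certificates (P : Plant nx nu nw) (hSq : P.Sq.det ≠ 0) (hSr : P.Sr.det ≠ 0)
    (hβ0 : 0 < β) (hβ : ∀ x, β * (x ⬝ᵥ x) ≤ (P.Bwᵀ *ᵥ x) ⬝ᵥ (P.Bwᵀ *ᵥ x)) (c : ℝ) :
    IsCompact (P.certificates c) := by
  set cK : ℝ := c ^ 2 * (∑ i, ∑ j, (P.Srᵀ⁻¹) i j ^ 2) / β with hcK
  set cX : ℝ := c ^ 2 * (∑ i, ∑ j, (P.Sqᵀ⁻¹) i j ^ 2) with hcX
  have hbox : ∀ (k l : ℕ) (r : ℝ), IsCompact {M : Matrix (Fin k) (Fin l) ℝ |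
      ∀ i ∈ Set.univ, M i ∈ {v | ∀ j ∈ Set.univ, v j ∈ Set.Icc (-r) r}} := fun k l r =>
    isCompact_univ_pi fun _ => isCompact_univ_pi fun _ => isCompact_Icc
  refine IsCompact.of_isClosed_subset ((isCompact_Icc (a := 0) (b := c)).prod
    ((hbox nu nx (Real.sqrt cK)).prod (hbox nx nx cX))) (P.isClosed_certificates c) ?_
  rintro ⟨g, K, X⟩ ⟨hg, hX, hX0, h⟩
  have hg2 : g ^ 2 ≤ c ^ 2 := pow_le_pow_left₀ hg.1 hg.2 2
  refine ⟨hg, fun i _ j _ => ?_, fun i _ j _ => ?_⟩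
  · refine abs_le.1 (Real.abs_le_sqrt ((h.gain_le hX0 hβ0 hβ hSr (sq_nonneg g) i j).trans ?_))
    rw [hcK]
    gcongr
  · refine abs_le.1 (abs_apply_le_of_quadratic_bound hX hX0 (fun x => ?_) i j)
    refine (h.storage_le hSq (sq_nonneg g) x).trans ?_
    have := zero_le_dotProduct_self x
    rw [hcX]
    gcongr

/-- The `H∞` norm attains its minimum over the stabilizing gains: minimize the level over a compact
set of certificates; the gain of the minimizing certificate is stabilizing. -/
theorem exists_optimal_gain (P : Plant nx nu nw) (hSq : P.Sq.det ≠ 0) (hSr : P.Sr.det ≠ 0)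
    (hβ0 : 0 < β) (hβ : ∀ x, β * (x ⬝ᵥ x) ≤ (P.Bwᵀ *ᵥ x) ⬝ᵥ (P.Bwᵀ *ᵥ x))
    (hstab : ∃ K, SchurStable (P.closedLoop K)) :
    ∃ K, SchurStable (P.closedLoop K) ∧
      ∀ K', SchurStable (P.closedLoop K') → P.hinf K ≤ P.hinf K' := by
  obtain ⟨K0, hK0⟩ := hstab
  have hmem : ∀ K, SchurStable (P.closedLoop K) → P.hinf K ≤ P.hinf K0 → ∃ X,
      (P.hinf K, K, X) ∈ P.certificates (P.hinf K0) := by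
    intro K hK hle
    obtain ⟨X, hX, hX0, h⟩ := exists_certificate hSq hK le_rfl
    exact ⟨X, ⟨hinf_nonneg, hle⟩, hX, hX0, h⟩
  obtain ⟨X0, hX0⟩ := hmem K0 hK0 le_rfl
  obtain ⟨⟨g, K, X⟩, ⟨hg, _, hXpos, h⟩, hmin⟩ :=
    (P.isCompact_certificates hSq hSr hβ0 hβ (P.hinf K0)).exists_isMinOn ⟨_, hX0⟩
      continuous_fst.continuousOn
  have hK : SchurStable (P.closedLoop K) := h.schurStable hXpos hβ0 hβ
  refine ⟨K, hK, fun K' hK' => ?_⟩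
  have hle : P.hinf K ≤ g := h.hinf_le hg.1 (regular_of_schurStable hK)
  rcases le_total (P.hinf K') (P.hinf K0) with h' | h'
  · obtain ⟨X', hX'⟩ := hmem K' hK' h'
    exact hle.trans (hmin hX')
  · exact (hle.trans hg.2).trans h'

/-! ### Convexity of the certificates and descent directions -/

/-- The certificates are convex in `(X, K X, g)`; on the segment from `(X₀, K₀ X₀, g₀)` to
`(X₁, K₁ X₁, g₁)` the gain is `K₀ + t (K₁ - K₀) X₁ Xₜ⁻¹`. The inequality rests on the joint
convexity of `(ξ, X) ↦ ξᵀ X⁻¹ ξ`. -/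
theorem Certificate.convex {K₀ K₁ : Matrix (Fin nu) (Fin nx) ℝ}
    {X₀ X₁ Xt : Matrix (Fin nx) (Fin nx) ℝ} {g₀ g₁ t : ℝ} (h₀ : P.Certificate K₀ X₀ g₀)
    (h₁ : P.Certificate K₁ X₁ g₁) (hX₀ : X₀ᵀ = X₀) (hX₁ : X₁ᵀ = X₁)
    (hp₀ : ∀ x, 0 ≤ x ⬝ᵥ X₀ *ᵥ x) (hp₁ : ∀ x, 0 ≤ x ⬝ᵥ X₁ *ᵥ x) (ht0 : 0 ≤ t) (ht1 : t ≤ 1)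
    (hXt : Xt = (1 - t) • X₀ + t • X₁) (hdet : Xt.det ≠ 0) :
    P.Certificate (K₀ + t • ((K₁ - K₀) * X₁ * Xt⁻¹)) Xt ((1 - t) * g₀ + t * g₁) := by
  intro x y
  have e₀ := h₀ x y
  have e₁ := h₁ x y
  rw [dual_step] at e₀ e₁ ⊢
  set w := P.Aᵀ *ᵥ x + P.Sqᵀ *ᵥ (y ∘ Sum.inl)
  set w' := P.Bᵀ *ᵥ x + P.Srᵀ *ᵥ (y ∘ Sum.inr)
  set K := K₀ + t • ((K₁ - K₀) * X₁ * Xt⁻¹) with hK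
  have hXtT : Xtᵀ = Xt := by
    rw [hXt, transpose_add, transpose_smul, transpose_smul, hX₀, hX₁]
  have hKX : Xt * Kᵀ = (1 - t) • (X₀ * K₀ᵀ) + t • (X₁ * K₁ᵀ) := by
    have hinv : (K₁ - K₀) * X₁ * Xt⁻¹ * Xt = (K₁ - K₀) * X₁ :=
      nonsing_inv_mul_cancel_right _ _ (isUnit_iff_ne_zero.2 hdet)
    have : K * Xt = (1 - t) • (K₀ * X₀) + t • (K₁ * X₁) := by
      rw [hK, Matrix.add_mul, Matrix.smul_mul, hinv, hXt, Matrix.mul_add, Matrix.sub_mul,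
        Matrix.mul_smul, Matrix.mul_smul]
      module
    have := congrArg Matrix.transpose this
    simpa only [transpose_mul, transpose_add, transpose_smul, hXtT, hX₀, hX₁] using this
  set η₀ := w + K₀ᵀ *ᵥ w' with hη₀
  set η₁ := w + K₁ᵀ *ᵥ w' with hη₁
  set η := w + Kᵀ *ᵥ w' with hη
  -- The successor state `η` is the mean of `η₀` and `η₁` weighted by `(1 - t) X₀` and `t X₁`.
  have hη' : Xt *ᵥ η = (1 - t) • (X₀ *ᵥ η₀) + t • (X₁ *ᵥ η₁) := by
    rw [hη, mulVec_add, mulVec_mulVec, hKX, hXt]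
    simp only [hη₀, hη₁, mulVec_add, mulVec_mulVec, add_mulVec, smul_mulVec]
    module
  have hsymm : ∀ (X : Matrix (Fin nx) (Fin nx) ℝ), Xᵀ = X → ∀ u v,
      u ⬝ᵥ X *ᵥ v = v ⬝ᵥ X *ᵥ u := by
    intro X hX u v
    rw [dotProduct_mulVec, ← mulVec_transpose, hX, dotProduct_comm]
  -- Nonnegativity of the weighted variance of `η₀`, `η₁` about `η` is the required convexity.
  have q₀ := hp₀ (η₀ - η)
  have q₁ := hp₁ (η₁ - η)
  simp only [mulVec_sub, dotProduct_sub, sub_dotProduct, hsymm X₀ hX₀ η₀ η,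
    hsymm X₁ hX₁ η₁ η] at q₀ q₁
  have m1 : η ⬝ᵥ Xt *ᵥ η = (1 - t) * (η ⬝ᵥ X₀ *ᵥ η₀) + t * (η ⬝ᵥ X₁ *ᵥ η₁) := by
    rw [hη', dotProduct_add, dotProduct_smul, dotProduct_smul, smul_eq_mul, smul_eq_mul]
  have m2 : ∀ v, v ⬝ᵥ Xt *ᵥ v = (1 - t) * (v ⬝ᵥ X₀ *ᵥ v) + t * (v ⬝ᵥ X₁ *ᵥ v) := by
    intro v
    rw [hXt, add_mulVec, smul_mulVec, smul_mulVec, dotProduct_add, dotProduct_smul,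
      dotProduct_smul, smul_eq_mul, smul_eq_mul]
  have m3 := m2 η
  have m4 := m2 x
  have r₀ := mul_le_mul_of_nonneg_left e₀ (sub_nonneg.2 ht1)
  have r₁ := mul_le_mul_of_nonneg_left e₁ ht0
  have s₀ := mul_nonneg (sub_nonneg.2 ht1) q₀
  have s₁ := mul_nonneg ht0 q₁
  linarith

theorem det_ne_zero_of_quadratic_pos {k : Type*} [Fintype k] [DecidableEq k] {X : Matrix k k ℝ}
    (hβ0 : 0 < β) (h : ∀ x, β * (x ⬝ᵥ x) ≤ x ⬝ᵥ X *ᵥ x) : X.det ≠ 0 := by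
  intro hdet
  obtain ⟨v, hv, hXv⟩ := exists_mulVec_eq_zero_iff.2 hdet
  have h1 := h v
  rw [hXv, dotProduct_zero] at h1
  exact absurd h1 (not_le.2 (mul_pos hβ0 (dotProduct_self_pos hv)))

/-- If a gain is not optimal, then nearby gains with a proportionally smaller `H∞` norm exist. -/
theorem exists_descent (hSq : P.Sq.det ≠ 0) (hβ0 : 0 < β)
    (hβ : ∀ x, β * (x ⬝ᵥ x) ≤ (P.Bwᵀ *ᵥ x) ⬝ᵥ (P.Bwᵀ *ᵥ x))
    {K₀ K₁ : Matrix (Fin nu) (Fin nx) ℝ} (hK₀ : SchurStable (P.closedLoop K₀))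
    (hK₁ : SchurStable (P.closedLoop K₁)) (hlt : P.hinf K₁ < P.hinf K₀) :
    ∃ c > 0, ∃ d, ∀ t, 0 ≤ t → t ≤ 1 → ∃ D : Matrix (Fin nu) (Fin nx) ℝ, ‖D‖ ≤ d ∧
      (P.Regular (K₀ + t • D) → P.hinf (K₀ + t • D) ≤ P.hinf K₀ - c * t) := by
  obtain ⟨X₀, hX₀, hp₀, h₀⟩ := exists_certificate hSq hK₀ le_rfl
  obtain ⟨X₁, hX₁, hp₁, h₁⟩ := exists_certificate hSq hK₁ le_rfl
  set Xt : ℝ → Matrix (Fin nx) (Fin nx) ℝ := fun t => (1 - t) • X₀ + t • X₁ with hXt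
  have hdet : ∀ t ∈ Set.Icc (0 : ℝ) 1, (Xt t).det ≠ 0 := by
    intro t ht
    refine det_ne_zero_of_quadratic_pos hβ0 fun x => ?_
    have l₀ := mul_le_mul_of_nonneg_left (h₀.le_storage hp₀ hβ x) (sub_nonneg.2 ht.2)
    have l₁ := mul_le_mul_of_nonneg_left (h₁.le_storage hp₁ hβ x) ht.1
    rw [hXt, add_mulVec, smul_mulVec, smul_mulVec, dotProduct_add, dotProduct_smul,
      dotProduct_smul, smul_eq_mul, smul_eq_mul]
    linarith
  have hcont : ContinuousOn (fun t => (K₁ - K₀) * X₁ * (Xt t)⁻¹) (Set.Icc 0 1) := by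
    intro t ht
    have : ContinuousAt (fun t => (Xt t)⁻¹) t :=
      ContinuousAt.matrix_inv (by rw [hXt]; fun_prop) (hdet t ht)
    exact ((continuous_const.matrix_mul continuous_id).continuousAt.comp this).continuousWithinAt
  obtain ⟨d, hd⟩ := isCompact_Icc.exists_bound_of_continuousOn hcont
  have hpos : 0 < P.hinf K₀ := hinf_nonneg.trans_lt hlt
  have hnn : 0 ≤ P.hinf K₁ := hinf_nonneg
  set c := (P.hinf K₀ ^ 2 - P.hinf K₁ ^ 2) / (2 * P.hinf K₀) with hc
  have hc' : c * (2 * P.hinf K₀) = P.hinf K₀ ^ 2 - P.hinf K₁ ^ 2 :=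
    div_mul_cancel₀ _ (by positivity)
  have hc0 : 0 < c := div_pos (by nlinarith) (by positivity)
  have hcle : c ≤ P.hinf K₀ := by nlinarith
  -- `c` is chosen such that `(1 - t) J(K₀)² + t J(K₁)² = J(K₀)² - 2 c t J(K₀) ≤ (J(K₀) - c t)²`.
  refine ⟨c, hc0, d, fun t ht0 ht1 => ⟨_, hd t ⟨ht0, ht1⟩, fun hreg => ?_⟩⟩
  have hle : 0 ≤ P.hinf K₀ - c * t := by nlinarith
  have hcert := h₀.convex h₁ hX₀ hX₁ hp₀ hp₁ ht0 ht1 rfl (hdet t ⟨ht0, ht1⟩)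
  refine Certificate.hinf_le (X := Xt t) (fun x y => (hcert x y).trans ?_) hle hreg
  have := zero_le_dotProduct_self y
  gcongr
  nlinarith [sq_nonneg (c * t)]

end Plant

/-! ### Local weak convexity of the `H∞` norm -/

theorem dotProduct_self_eq_norm_sq {k : Type*} [Fintype k] (v : k → ℝ) :
    v ⬝ᵥ v = ‖WithLp.toLp 2 v‖ ^ 2 := by
  simp [EuclideanSpace.norm_sq_eq, dotProduct, ← sq]

theorem norm_toComplex_le {k l : Type*} [Fintype k] [Fintype l] [DecidableEq l]
    (M : Matrix k l ℝ) : ‖toComplex M‖ ≤ ‖M‖ := by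
  have h : ∀ v : l → ℝ, (M *ᵥ v) ⬝ᵥ (M *ᵥ v) ≤ ‖M‖ ^ 2 * (v ⬝ᵥ v) := by
    intro v
    rw [dotProduct_self_eq_norm_sq, dotProduct_self_eq_norm_sq, ← mul_pow]
    gcongr
    exact l2_opNorm_mulVec M (WithLp.toLp 2 v)
  refine norm_le_of_normSq_le (norm_nonneg M) fun v => ?_
  rw [normSq_eq_re_add_im, normSq_eq_re_add_im]
  simp only [re_toComplex_mulVec, im_toComplex_mulVec]
  linarith [h fun j => (v j).re, h fun j => (v j).im]

theorem toComplex_add {k l : Type*} (M N : Matrix k l ℝ) :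
    toComplex (M + N) = toComplex M + toComplex N := by
  ext i j; simp [toComplex]

theorem toComplex_smul {k l : Type*} (t : ℝ) (M : Matrix k l ℝ) :
    toComplex (t • M) = (t : ℂ) • toComplex M := by
  ext i j; simp [toComplex]

namespace Plant

variable {nx nu nw : ℕ} (P : Plant nx nu nw)

/-- The dependence of the closed-loop state matrix on the gain. -/
def stateVar (D : Matrix (Fin nu) (Fin nx) ℝ) : Matrix (Fin nx) (Fin nx) ℂ :=
  toComplex (P.B * D)

/-- The dependence of the closed-loop output matrix on the gain. -/
def outputVar (D : Matrix (Fin nu) (Fin nx) ℝ) : Matrix (Fin nx ⊕ Fin nu) (Fin nx) ℂ :=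
  toComplex (fromRows (0 : Matrix (Fin nx) (Fin nx) ℝ) (P.Sr * D))

/-- The factor common to the first-order term and to the remainder in the expansion of the
transfer matrix at `K` in the direction `D`. -/
def derivFactor (K D : Matrix (Fin nu) (Fin nx) ℝ) (z : ℂ) : Matrix (Fin nx ⊕ Fin nu) (Fin nx) ℂ :=
  (toComplex (P.output K) * (P.pencil K z)⁻¹ * P.stateVar D + P.outputVar D) * (P.pencil K z)⁻¹

/-- The derivative of the transfer matrix at `K` in the direction `D`. -/
def transferDeriv (K D : Matrix (Fin nu) (Fin nx) ℝ) (z : ℂ) :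
    Matrix (Fin nx ⊕ Fin nu) (Fin nw) ℂ :=
  P.derivFactor K D z * toComplex P.Bw

variable {P}

theorem toComplex_output_add (K D : Matrix (Fin nu) (Fin nx) ℝ) :
    toComplex (P.output (K + D)) = toComplex (P.output K) + P.outputVar D := by
  rw [outputVar, ← toComplex_add, output, output, Matrix.mul_add]
  congr 1
  ext (i | i) j <;> simp

theorem pencil_add (K D : Matrix (Fin nu) (Fin nx) ℝ) (z : ℂ) :
    P.pencil (K + D) z = P.pencil K z - P.stateVar D := by
  rw [pencil, pencil, stateVar, closedLoop, closedLoop, Matrix.mul_add, ← add_assoc,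
    toComplex_add, sub_sub]

theorem stateVar_smul (t : ℝ) (D : Matrix (Fin nu) (Fin nx) ℝ) :
    P.stateVar (t • D) = (t : ℂ) • P.stateVar D := by
  rw [stateVar, Matrix.mul_smul, toComplex_smul, stateVar]

theorem outputVar_smul (t : ℝ) (D : Matrix (Fin nu) (Fin nx) ℝ) :
    P.outputVar (t • D) = (t : ℂ) • P.outputVar D := by
  rw [outputVar, outputVar, ← toComplex_smul, Matrix.mul_smul]
  congr 1
  ext (i | i) j <;> simp

/-- The resolvent identity. -/
theorem inv_sub_eq {k : Type*} [Fintype k] [DecidableEq k] {N E : Matrix k k ℂ}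
    (hN : N.det ≠ 0) (hNE : (N - E).det ≠ 0) : (N - E)⁻¹ = N⁻¹ + N⁻¹ * E * (N - E)⁻¹ := by
  have h1 : N⁻¹ * N = 1 := nonsing_inv_mul _ (isUnit_iff_ne_zero.2 hN)
  have h2 : (N - E) * (N - E)⁻¹ = 1 := mul_nonsing_inv _ (isUnit_iff_ne_zero.2 hNE)
  calc (N - E)⁻¹ = N⁻¹ * N * (N - E)⁻¹ := by rw [h1, Matrix.one_mul]
    _ = N⁻¹ * ((N - E) * (N - E)⁻¹) + N⁻¹ * E * (N - E)⁻¹ := by noncomm_ring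
    _ = _ := by rw [h2, Matrix.mul_one]

theorem transfer_expansion {K D : Matrix (Fin nu) (Fin nx) ℝ} {t : ℝ} {z : ℂ}
    (h0 : (P.pencil K z).det ≠ 0) (ht : (P.pencil (K + t • D) z).det ≠ 0) :
    P.transfer (K + t • D) z = P.transfer K z + (t : ℂ) • P.transferDeriv K D z +
      ((t : ℂ) ^ 2) • (P.derivFactor K D z * P.stateVar D * (P.pencil (K + t • D) z)⁻¹ *
        toComplex P.Bw) := by
  have hR := inv_sub_eq (E := (t : ℂ) • P.stateVar D) h0 (by rwa [← stateVar_smul, ← pencil_add])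
  rw [← stateVar_smul, ← pencil_add, stateVar_smul] at hR
  set R := (P.pencil (K + t • D) z)⁻¹
  set R₀ := (P.pencil K z)⁻¹ with hR₀
  set E := P.stateVar D with hE
  set F := P.outputVar D with hF
  set C₀ := toComplex (P.output K) with hC₀
  have hR2 : R = R₀ + (t : ℂ) • (R₀ * E * R₀) + ((t : ℂ) ^ 2) • (R₀ * E * R₀ * E * R) := by
    conv_lhs => rw [hR, hR]
    simp only [Matrix.mul_smul, Matrix.smul_mul, Matrix.mul_add, smul_smul, sq,
      Matrix.mul_assoc, add_assoc]
  have key : (C₀ + (t : ℂ) • F) * R = C₀ * R₀ + (t : ℂ) • ((C₀ * R₀ * E + F) * R₀) +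
      ((t : ℂ) ^ 2) • ((C₀ * R₀ * E + F) * R₀ * E * R) := by
    have e1 : C₀ * R = C₀ * R₀ + (t : ℂ) • (C₀ * R₀ * E * R₀)
        + ((t : ℂ) ^ 2) • (C₀ * R₀ * E * R₀ * E * R) := by
      conv_lhs => rw [hR2]
      simp only [Matrix.mul_smul, Matrix.mul_add, Matrix.mul_assoc]
    have e2 : (t : ℂ) • F * R = (t : ℂ) • (F * R₀) + ((t : ℂ) ^ 2) • (F * R₀ * E * R) := by
      conv_lhs => rw [hR]
      simp only [Matrix.mul_smul, Matrix.smul_mul, Matrix.mul_add, smul_smul, sq,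
        Matrix.mul_assoc]
    rw [Matrix.add_mul, e1, e2]
    simp only [Matrix.add_mul, smul_add]
    abel
  rw [transfer, toComplex_output_add, outputVar_smul, key, transfer, transferDeriv, derivFactor]
  simp only [Matrix.add_mul, Matrix.smul_mul, smul_add]
  rfl

theorem exists_norm_stateVar_le (P : Plant nx nu nw) :
    ∃ e ≥ 0, ∀ D, ‖P.stateVar D‖ ≤ e * ‖D‖ :=
  ⟨‖P.B‖, norm_nonneg _, fun _ => (norm_toComplex_le _).trans (l2_opNorm_mul _ _)⟩

theorem exists_norm_outputVar_le (P : Plant nx nu nw) :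
    ∃ f ≥ 0, ∀ D, ‖P.outputVar D‖ ≤ f * ‖D‖ := by
  set Lf : Matrix (Fin nu) (Fin nx) ℝ →ₗ[ℝ] Matrix (Fin nx ⊕ Fin nu) (Fin nx) ℝ :=
    { toFun := fun D => fromRows (0 : Matrix (Fin nx) (Fin nx) ℝ) (P.Sr * D)
      map_add' := fun D D' => by ext (i | i) j <;> simp [Matrix.mul_add]
      map_smul' := fun c D => by ext (i | i) j <;> simp }
  obtain ⟨f, hf, h⟩ := (LinearMap.toContinuousLinearMap Lf).bound
  exact ⟨f, hf.le, fun D => (norm_toComplex_le _).trans (h D)⟩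

/-- Near a regular gain, the resolvent is bounded uniformly on the unit circle. -/
theorem Regular.exists_inv_pencil_bound {K₀ : Matrix (Fin nu) (Fin nx) ℝ} (hK : P.Regular K₀) :
    ∃ r > 0, ∃ M ≥ 0, ∀ K, ‖K - K₀‖ < r → P.Regular K ∧
      ∀ z : ℂ, ‖z‖ = 1 → ‖(P.pencil K z)⁻¹‖ ≤ M := by
  have hcont : ContinuousOn (fun z => (P.pencil K₀ z)⁻¹) (Metric.sphere (0 : ℂ) 1) := by
    intro z hz
    refine (ContinuousAt.matrix_inv ?_ (hK z (by simpa using hz))).continuousWithinAt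
    unfold pencil
    fun_prop
  obtain ⟨M₀, hM₀⟩ := (isCompact_sphere (0 : ℂ) 1).exists_bound_of_continuousOn hcont
  obtain ⟨e, he, hE⟩ := P.exists_norm_stateVar_le
  set M := max M₀ 0 with hM
  have hM0 : 0 ≤ M := le_max_right _ _
  have hMe : 0 ≤ M * e := mul_nonneg hM0 he
  refine ⟨1 / (2 * (M * e + 1)), by positivity, 2 * M, by positivity, fun K hKK => ?_⟩
  have hsmall : ∀ z : ℂ, ‖z‖ = 1 → ‖(P.pencil K₀ z)⁻¹ * P.stateVar (K - K₀)‖ ≤ 1 / 2 := by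
    intro z hz
    have h1 : ‖(P.pencil K₀ z)⁻¹‖ ≤ M := (hM₀ z (by simpa using hz)).trans (le_max_left _ _)
    calc _ ≤ ‖(P.pencil K₀ z)⁻¹‖ * ‖P.stateVar (K - K₀)‖ := l2_opNorm_mul _ _
      _ ≤ M * (e * ‖K - K₀‖) := mul_le_mul h1 (hE _) (norm_nonneg _) hM0
      _ ≤ M * (e * (1 / (2 * (M * e + 1)))) := by gcongr
      _ = M * e / (M * e + 1) * (1 / 2) := by field_simp
      _ ≤ 1 * (1 / 2) := by
        gcongr
        rw [div_le_one (by positivity)]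
        linarith
      _ = 1 / 2 := one_mul _
  have hsplit : ∀ z, P.pencil K z = P.pencil K₀ z - P.stateVar (K - K₀) := by
    intro z
    rw [← pencil_add, add_sub_cancel]
  have hreg : P.Regular K := by
    intro z hz
    have hu := isUnit_iff_ne_zero.2 (hK z hz)
    have h1 : P.pencil K z =
        P.pencil K₀ z * (1 - (P.pencil K₀ z)⁻¹ * P.stateVar (K - K₀)) := by
      rw [hsplit, Matrix.mul_sub, Matrix.mul_one, ← Matrix.mul_assoc, mul_nonsing_inv _ hu,
        Matrix.one_mul]
    have h2 : IsUnit (1 - (P.pencil K₀ z)⁻¹ * P.stateVar (K - K₀)) :=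
      isUnit_one_sub_of_norm_lt_one ((hsmall z hz).trans_lt (by norm_num))
    rw [h1, det_mul]
    exact mul_ne_zero (hK z hz) ((isUnit_iff_isUnit_det _).1 h2).ne_zero
  refine ⟨hreg, fun z hz => ?_⟩
  have h1 := inv_sub_eq (hK z hz) (by rw [← hsplit]; exact hreg z hz)
  rw [← hsplit] at h1
  have h2 : ‖(P.pencil K z)⁻¹‖ ≤ M + 1 / 2 * ‖(P.pencil K z)⁻¹‖ := by
    conv_lhs => rw [h1]
    refine (norm_add_le _ _).trans (add_le_add ?_ ((l2_opNorm_mul _ _).trans ?_))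
    · exact (hM₀ z (by simpa using hz)).trans (le_max_left _ _)
    · gcongr
      exact hsmall z hz
  linarith

/-- The first-order expansion of the transfer matrix, uniform near a regular gain and on the unit
circle. -/
theorem Regular.exists_expansion_bound {K₀ : Matrix (Fin nu) (Fin nx) ℝ} (hK : P.Regular K₀) :
    ∃ r > 0, ∃ L ≥ 0, ∃ ρ ≥ 0, ∀ K, ‖K - K₀‖ < r → P.Regular K ∧
      ∀ (D : Matrix (Fin nu) (Fin nx) ℝ) (t : ℝ), ‖K + t • D - K₀‖ < r → ∀ z : ℂ, ‖z‖ = 1 →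
        ‖P.transferDeriv K D z‖ ≤ L * ‖D‖ ∧ ∃ S, ‖S‖ ≤ ρ * ‖D‖ ^ 2 ∧
        P.transfer (K + t • D) z =
          P.transfer K z + (t : ℂ) • P.transferDeriv K D z + ((t : ℂ) ^ 2) • S := by
  obtain ⟨r, hr, M, hM0, hM⟩ := hK.exists_inv_pencil_bound
  obtain ⟨e, he, hE⟩ := P.exists_norm_stateVar_le
  obtain ⟨f, hf, hF⟩ := P.exists_norm_outputVar_le
  set b := ‖toComplex P.Bw‖ with hb
  set c := ‖toComplex (P.output K₀)‖ + f * r with hc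
  have hb0 : 0 ≤ b := norm_nonneg _
  have hc0 : 0 ≤ c := by positivity
  set w := (c * M * e + f) * M with hw
  have hw0 : 0 ≤ w := by positivity
  refine ⟨r, hr, w * b, by positivity, w * e * M * b, by positivity, fun K hKr => ?_⟩
  obtain ⟨hreg, hR⟩ := hM K hKr
  refine ⟨hreg, fun D t ht z hz => ?_⟩
  obtain ⟨hregt, hRt⟩ := hM _ ht
  have hC : ‖toComplex (P.output K)‖ ≤ c := by
    have : toComplex (P.output K) = toComplex (P.output K₀) + P.outputVar (K - K₀) := by
      rw [← toComplex_output_add, add_sub_cancel]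
    rw [this]
    refine (norm_add_le _ _).trans (add_le_add le_rfl ((hF _).trans ?_))
    gcongr
  have hW : ‖P.derivFactor K D z‖ ≤ w * ‖D‖ := by
    have h1 : ‖toComplex (P.output K) * (P.pencil K z)⁻¹ * P.stateVar D‖ ≤ c * M * (e * ‖D‖) :=
      (l2_opNorm_mul _ _).trans (mul_le_mul ((l2_opNorm_mul _ _).trans
        (mul_le_mul hC (hR z hz) (norm_nonneg _) hc0)) (hE D) (norm_nonneg _) (by positivity))
    calc _ ≤ ‖toComplex (P.output K) * (P.pencil K z)⁻¹ * P.stateVar D + P.outputVar D‖ *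
          ‖(P.pencil K z)⁻¹‖ := l2_opNorm_mul _ _
      _ ≤ (c * M * (e * ‖D‖) + f * ‖D‖) * M :=
        mul_le_mul ((norm_add_le _ _).trans (add_le_add h1 (hF D))) (hR z hz) (norm_nonneg _)
          (by positivity)
      _ = w * ‖D‖ := by rw [hw]; ring
  refine ⟨?_, _, ?_, transfer_expansion (hreg z hz) (hregt z hz)⟩
  · calc _ ≤ ‖P.derivFactor K D z‖ * b := l2_opNorm_mul _ _
      _ ≤ w * ‖D‖ * b := by gcongr
      _ = w * b * ‖D‖ := by ring
  · calc _ ≤ ‖P.derivFactor K D z‖ * ‖P.stateVar D‖ * ‖(P.pencil (K + t • D) z)⁻¹‖ * b := by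
          refine (l2_opNorm_mul _ _).trans ?_
          gcongr
          refine (l2_opNorm_mul _ _).trans ?_
          gcongr
          exact l2_opNorm_mul _ _
      _ ≤ w * ‖D‖ * (e * ‖D‖) * M * b := by
          gcongr
          · exact hE D
          · exact hRt z hz
      _ = w * e * M * b * ‖D‖ ^ 2 := by ring

end Plant

/-! ### Clarke subgradients of the `H∞` norm -/

namespace Plant

variable {nx nu nw : ℕ} {P : Plant nx nu nw} {K₀ : Matrix (Fin nu) (Fin nx) ℝ}

/-- Near a regular gain, the `H∞` norm is Lipschitz, and convex along segments up to an error that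
is quadratic in the length of the segment. -/
theorem Regular.exists_weakly_convex (hK : P.Regular K₀) :
    ∃ r > 0, ∃ Λ ≥ 0, ∃ ρ ≥ 0, (∀ K, ‖K - K₀‖ < r → P.Regular K) ∧
      (∀ K K', ‖K - K₀‖ < r → ‖K' - K₀‖ < r → P.hinf K' ≤ P.hinf K + Λ * ‖K' - K‖) ∧
      ∀ (K D : Matrix (Fin nu) (Fin nx) ℝ) (s t : ℝ), 0 < t → t ≤ s → ‖K - K₀‖ < r →
        ‖K + t • D - K₀‖ < r → ‖K + s • D - K₀‖ < r →
        (P.hinf (K + t • D) - P.hinf K) / t ≤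
          (P.hinf (K + s • D) - P.hinf K) / s + 2 * ρ * ‖D‖ ^ 2 * s := by
  obtain ⟨r, hr, L, hL, ρ, hρ, h⟩ := hK.exists_expansion_bound
  refine ⟨r, hr, L + ρ * (2 * r), by positivity, ρ, hρ, fun K hK => (h K hK).1, ?_, ?_⟩
  · intro K K' hKr hKr'
    obtain ⟨hreg, hexp⟩ := h K hKr
    have hsub : K + (1 : ℝ) • (K' - K) = K' := by rw [one_smul, add_sub_cancel]
    have hdist : ‖K' - K‖ ≤ 2 * r := by
      have := norm_sub_le (K' - K₀) (K - K₀)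
      rw [sub_sub_sub_cancel_right] at this
      linarith
    refine hinf_le fun z hz => ?_
    obtain ⟨h1, S, hS, heq⟩ := hexp (K' - K) 1 (by rwa [hsub]) z hz
    rw [hsub] at heq
    rw [heq]
    simp only [Complex.ofReal_one, one_smul, one_pow]
    have h2 := norm_add₃_le (a := P.transfer K z) (b := P.transferDeriv K (K' - K) z) (c := S)
    have h3 := hreg.norm_transfer_le_hinf hz
    have h4 : ρ * ‖K' - K‖ ^ 2 ≤ ρ * (2 * r) * ‖K' - K‖ := by
      rw [sq, ← mul_assoc]
      gcongr
    linarith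
  · intro K D s t ht hts hKr htr hsr
    have hs : 0 < s := ht.trans_le hts
    obtain ⟨hreg, hexp⟩ := h K hKr
    have hregs := (h _ hsr).1
    set a := t / s with ha
    have ha0 : 0 ≤ a := by positivity
    have ha1 : a ≤ 1 := (div_le_one hs).2 hts
    have has : a * s = t := div_mul_cancel₀ _ hs.ne'
    have key : P.hinf (K + t • D) ≤ (1 - a) * P.hinf K + a * P.hinf (K + s • D) +
        2 * ρ * ‖D‖ ^ 2 * s * t := by
      refine hinf_le fun z hz => ?_
      obtain ⟨-, S, hS, heq⟩ := hexp D t htr z hz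
      obtain ⟨-, S', hS', heq'⟩ := hexp D s hsr z hz
      -- The first-order terms of the expansions at `t` and `s` cancel.
      have hcomb : P.transfer (K + t • D) z = ((1 - a : ℝ) : ℂ) • P.transfer K z +
          (a : ℂ) • P.transfer (K + s • D) z +
          (((t ^ 2 : ℝ) : ℂ) • S - ((a * s ^ 2 : ℝ) : ℂ) • S') := by
        rw [heq, heq', ← has]
        push_cast
        module
      rw [hcomb]
      have hn : ∀ (c : ℝ) (M : Matrix (Fin nx ⊕ Fin nu) (Fin nw) ℂ), 0 ≤ c →
          ‖(c : ℂ) • M‖ = c * ‖M‖ := by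
        intro c M hc
        rw [norm_smul, Complex.norm_real, Real.norm_of_nonneg hc]
      refine (norm_add₃_le).trans (add_le_add (add_le_add ?_ ?_) ((norm_sub_le _ _).trans ?_))
      · rw [hn _ _ (sub_nonneg.2 ha1)]
        exact mul_le_mul_of_nonneg_left (hreg.norm_transfer_le_hinf hz) (sub_nonneg.2 ha1)
      · rw [hn _ _ ha0]
        exact mul_le_mul_of_nonneg_left (hregs.norm_transfer_le_hinf hz) ha0
      · rw [hn _ _ (by positivity), hn _ _ (by positivity)]
        have e1 : t ^ 2 * ‖S‖ ≤ (s * t) * (ρ * ‖D‖ ^ 2) := by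
          rw [sq]
          gcongr
        have e2 : a * s ^ 2 * ‖S'‖ ≤ (s * t) * (ρ * ‖D‖ ^ 2) := by
          have : a * s ^ 2 = s * t := by rw [← has]; ring
          rw [this]
          gcongr
        linarith
    rw [div_le_iff₀ ht]
    have e : ((P.hinf (K + s • D) - P.hinf K) / s + 2 * ρ * ‖D‖ ^ 2 * s) * t =
        a * (P.hinf (K + s • D) - P.hinf K) + 2 * ρ * ‖D‖ ^ 2 * s * t := by
      rw [ha]; ring
    rw [e]
    linarith

/-- A direction along which the `H∞` norm decreases at a positive rate up to `o(t)` is, by weak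
convexity, a direction of strict descent in the sense of Clarke. -/
theorem Regular.exists_clarkeDeriv_le (hK : P.Regular K₀) {c d : ℝ} (hc : 0 < c)
    (hdesc : ∀ t, 0 ≤ t → t ≤ 1 → ∃ D : Matrix (Fin nu) (Fin nx) ℝ, ‖D‖ ≤ d ∧
      (P.Regular (K₀ + t • D) → P.hinf (K₀ + t • D) ≤ P.hinf K₀ - c * t)) :
    ∃ D : Matrix (Fin nu) (Fin nx) ℝ, clarkeDeriv P.hinf K₀ D ≤ ((-(c / 2) : ℝ) : EReal) := by
  obtain ⟨r, hr, Λ, hΛ, ρ, hρ, hreg, hlip, hconv⟩ := hK.exists_weakly_convex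
  have hd : 0 ≤ d := by
    obtain ⟨D, hD, -⟩ := hdesc 0 le_rfl zero_le_one
    exact (norm_nonneg D).trans hD
  -- The step `s` is small enough for the second-order error and for staying near `K₀`.
  obtain ⟨s, hs0, hs1, hsr, hsρ⟩ : ∃ s > 0, s ≤ 1 ∧ s * d < r / 2 ∧ 2 * ρ * d ^ 2 * s ≤ c / 4 := by
    have h1 : Tendsto (fun s : ℝ => s * d) (𝓝[>] 0) (𝓝 0) := by
      have : Continuous fun s : ℝ => s * d := by fun_prop
      simpa using (this.tendsto 0).mono_left nhdsWithin_le_nhds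
    have h2 : Tendsto (fun s : ℝ => 2 * ρ * d ^ 2 * s) (𝓝[>] 0) (𝓝 0) := by
      have : Continuous fun s : ℝ => 2 * ρ * d ^ 2 * s := by fun_prop
      simpa using (this.tendsto 0).mono_left nhdsWithin_le_nhds
    obtain ⟨s, hs⟩ := ((h1.eventually_lt_const (half_pos hr)).and
      ((h2.eventually_lt_const (by positivity : 0 < c / 4)).and
        (Ioc_mem_nhdsGT (zero_lt_one' ℝ)))).exists
    exact ⟨s, hs.2.2.1, hs.2.2.2, hs.1, hs.2.1.le⟩
  obtain ⟨D, hD, hdec⟩ := hdesc s hs0.le hs1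
  have hstep : ∀ t, 0 ≤ t → t ≤ s → ‖t • D‖ < r / 2 := by
    intro t ht0 hts
    rw [norm_smul, Real.norm_of_nonneg ht0]
    exact (mul_le_mul hts hD (norm_nonneg _) hs0.le).trans_lt hsr
  have hballs : ∀ K, ‖K - K₀‖ < r / 2 → ∀ t, 0 ≤ t → t ≤ s → ‖K + t • D - K₀‖ < r := by
    intro K hKr t ht0 hts
    rw [add_sub_right_comm]
    linarith [norm_add_le (K - K₀) (t • D), hstep t ht0 hts]
  have h0 : ‖K₀ + s • D - K₀‖ < r := hballs K₀ (by simpa using hr) s hs0.le le_rfl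
  have hdec' := hdec (hreg _ h0)
  refine ⟨D, limsup_le_of_le (h := ?_)⟩
  -- Moving the base point by less than `ε` changes the difference quotient at step `s` by at most
  -- `2 Λ ε / s ≤ c / 4`.
  set ε := min (r / 2) (c * s / (8 * (Λ + 1))) with hε
  have hε0 : 0 < ε := lt_min (by positivity) (by positivity)
  have hmem : Metric.ball K₀ ε ×ˢ Set.Ioc 0 s ∈ 𝓝 K₀ ×ˢ 𝓝[>] (0 : ℝ) :=
    prod_mem_prod (Metric.ball_mem_nhds _ hε0) (Ioc_mem_nhdsGT hs0)
  filter_upwards [hmem] with p hp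
  obtain ⟨hp1, hp2, hp3⟩ := hp
  rw [Metric.mem_ball, dist_eq_norm] at hp1
  have hpr : ‖p.1 - K₀‖ < r / 2 := hp1.trans_le (min_le_left _ _)
  have hpΛ : Λ * ‖p.1 - K₀‖ ≤ c * s / 8 := by
    have h1 : ‖p.1 - K₀‖ ≤ c * s / (8 * (Λ + 1)) := hp1.le.trans (min_le_right _ _)
    calc Λ * ‖p.1 - K₀‖ ≤ (Λ + 1) * (c * s / (8 * (Λ + 1))) := by
          gcongr
          linarith
      _ = c * s / 8 := by field_simp
  have hps := hballs p.1 hpr s hs0.le le_rfl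
  have h1 := hconv p.1 D s p.2 hp2 hp3 (by linarith) (hballs p.1 hpr p.2 hp2.le hp3) hps
  have h2 := hlip _ _ h0 hps
  have h3 := hlip p.1 K₀ (by linarith) (by simpa using hr)
  rw [add_sub_add_right_eq_sub] at h2
  rw [norm_sub_rev] at h3
  have h4 : (P.hinf (p.1 + s • D) - P.hinf p.1) / s ≤ -(3 * c / 4) := by
    rw [div_le_iff₀ hs0]
    linarith
  have h5 : 2 * ρ * ‖D‖ ^ 2 * s ≤ c / 4 := by
    refine le_trans ?_ hsρ
    gcongr
  exact_mod_cast (by linarith : (P.hinf (p.1 + p.2 • D) - P.hinf p.1) / p.2 ≤ -(c / 2))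

/-- The derivative of the transfer matrix is real-linear in the direction. -/
theorem exists_transferDeriv_addMonoidHom (P : Plant nx nu nw) (K : Matrix (Fin nu) (Fin nx) ℝ)
    (z : ℂ) :
    ∃ T : Matrix (Fin nu) (Fin nx) ℝ →+ Matrix (Fin nx ⊕ Fin nu) (Fin nw) ℂ,
      (∀ D, T D = P.transferDeriv K D z) ∧ ∀ (t : ℝ) D, T (t • D) = (t : ℂ) • T D := by
  have hadd : ∀ D D', P.stateVar (D + D') = P.stateVar D + P.stateVar D' := by
    intro D D'
    rw [stateVar, Matrix.mul_add, toComplex_add]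
    rfl
  have hadd' : ∀ D D', P.outputVar (D + D') = P.outputVar D + P.outputVar D' := by
    intro D D'
    rw [outputVar, outputVar, outputVar, ← toComplex_add, Matrix.mul_add]
    congr 1
    ext (i | i) j <;> simp
  refine ⟨AddMonoidHom.mk' (fun D => P.transferDeriv K D z) fun D D' => ?_, fun D => rfl,
    fun t D => ?_⟩
  · simp only [transferDeriv, derivFactor, hadd, hadd', Matrix.mul_add, Matrix.add_mul]
    abel
  · simp only [AddMonoidHom.mk'_apply, transferDeriv, derivFactor, stateVar_smul, outputVar_smul,
      Matrix.mul_smul, ← smul_add, Matrix.smul_mul]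

/-- The gradient of a smooth minorant of the `H∞` norm that touches it at `K₀` is a Clarke
subgradient: the minorant is `K ↦ re (f (T(K, z)))`, where `z` is a frequency at which the `H∞`
norm is attained and `f` is a functional norming the transfer matrix at `z`. -/
theorem Regular.clarkeSubdifferential_nonempty (hK : P.Regular K₀) :
    (clarkeSubdifferential P.hinf K₀).Nonempty := by
  obtain ⟨z, hz, hmax⟩ := hK.exists_hinf_eq
  obtain ⟨f, hf1, hf⟩ := exists_dual_vector'' ℂ (P.transfer K₀ z)
  obtain ⟨r, hr, L, hL, ρ, hρ, h⟩ := hK.exists_expansion_bound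
  obtain ⟨T, hT, hTsmul⟩ := P.exists_transferDeriv_addMonoidHom K₀ z
  set G : Matrix (Fin nu) (Fin nx) ℝ := Matrix.of fun i j => (f (T (Matrix.single i j 1))).re
    with hG
  have htrace : ∀ D : Matrix (Fin nu) (Fin nx) ℝ, (Gᵀ * D).trace = (f (T D)).re := by
    intro D
    have h1 : T D = ∑ i, ∑ j, ((D i j : ℝ) : ℂ) • T (Matrix.single i j 1) := by
      conv_lhs => rw [matrix_eq_sum_single D]
      simp only [map_sum, ← hTsmul, smul_single, smul_eq_mul, mul_one]
    rw [h1]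
    simp only [map_sum, map_smul, Complex.re_sum, smul_eq_mul, Complex.re_ofReal_mul, trace,
      diag_apply, mul_apply, transpose_apply, hG, Matrix.of_apply]
    rw [Finset.sum_comm]
    exact Finset.sum_congr rfl fun i _ => Finset.sum_congr rfl fun j _ => mul_comm _ _
  refine ⟨G, fun D => ?_⟩
  rw [htrace D]
  have hmap : Tendsto (fun t : ℝ => (K₀, t)) (𝓝[>] 0) (𝓝 K₀ ×ˢ 𝓝[>] (0 : ℝ)) :=
    tendsto_const_nhds.prodMk tendsto_id
  have hlow : Tendsto (fun t : ℝ => (((f (T D)).re - t * (ρ * ‖D‖ ^ 2) : ℝ) : EReal)) (𝓝[>] 0)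
      (𝓝 (((f (T D)).re : ℝ) : EReal)) := by
    have : Continuous fun t : ℝ => (((f (T D)).re - t * (ρ * ‖D‖ ^ 2) : ℝ) : EReal) :=
      continuous_coe_real_ereal.comp (by fun_prop)
    simpa using (this.tendsto 0).mono_left nhdsWithin_le_nhds
  have hnear : ∀ᶠ t : ℝ in 𝓝[>] 0, ‖K₀ + t • D - K₀‖ < r := by
    have : Continuous fun t : ℝ => ‖K₀ + t • D - K₀‖ := by fun_prop
    have h0 := (this.tendsto 0).mono_left (nhdsWithin_le_nhds (s := Set.Ioi 0))
    simp only [zero_smul, add_zero, sub_self, norm_zero] at h0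
    exact h0.eventually_lt_const hr
  rw [← hlow.limsup_eq, clarkeDeriv]
  refine le_trans (limsup_le_limsup ?_) (limsup_le_limsup_of_le hmap)
  filter_upwards [hnear, self_mem_nhdsWithin] with t htr ht
  have ht0 : 0 < t := ht
  obtain ⟨hreg, hexp⟩ := h K₀ (by simpa using hr)
  obtain ⟨-, S, hS, heq⟩ := hexp D t htr z hz
  have h1 : (f (P.transfer (K₀ + t • D) z)).re ≤ P.hinf (K₀ + t • D) :=
    ((Complex.re_le_norm _).trans (f.le_of_opNorm_le hf1 _)).trans
      ((one_mul _).le.trans ((h _ htr).1.norm_transfer_le_hinf hz))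
  have h2 : -(ρ * ‖D‖ ^ 2) ≤ (f S).re :=
    (neg_le_neg (((Complex.abs_re_le_norm _).trans (f.le_of_opNorm_le hf1 S)).trans
      ((one_mul _).le.trans hS))).trans (neg_abs_le _)
  have hre : (f (P.transfer K₀ z)).re = P.hinf K₀ := by
    rw [hf, hmax]
    exact Complex.ofReal_re _
  have h3 : (f (P.transfer (K₀ + t • D) z)).re =
      P.hinf K₀ + t * (f (T D)).re + t ^ 2 * (f S).re := by
    rw [heq, map_add, map_add, map_smul, map_smul, ← hT, Complex.add_re, Complex.add_re, hre,
      smul_eq_mul, smul_eq_mul, Complex.re_ofReal_mul, ← Complex.ofReal_pow,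
      Complex.re_ofReal_mul]
  rw [EReal.coe_le_coe_iff, le_div_iff₀ ht0]
  have h4 := mul_le_mul_of_nonneg_left h2 (sq_nonneg t)
  linarith

end Plant

/-- A direction of strict descent bounds the norm of all Clarke subgradients from below. -/
theorem exists_pos_le_distZero {m n : ℕ} {f : Matrix (Fin m) (Fin n) ℝ → ℝ}
    {K D : Matrix (Fin m) (Fin n) ℝ} {c : ℝ} (hc : 0 < c)
    (hD : clarkeDeriv f K D ≤ ((-c : ℝ) : EReal)) (hne : (clarkeSubdifferential f K).Nonempty) :
    ∃ δ > 0, δ ≤ distZero (clarkeSubdifferential f K) := by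
  have hcs : ∀ G : Matrix (Fin m) (Fin n) ℝ,
      -(Gᵀ * D).trace ≤ Real.sqrt (Gᵀ * G).trace * Real.sqrt (Dᵀ * D).trace := by
    intro G
    have h1 := Finset.sum_mul_sq_le_sq_mul_sq Finset.univ
      (fun p : Fin n × Fin m => G p.2 p.1) (fun p => D p.2 p.1)
    have e : ∀ M N : Matrix (Fin m) (Fin n) ℝ,
        (Mᵀ * N).trace = ∑ p : Fin n × Fin m, M p.2 p.1 * N p.2 p.1 := by
      intro M N
      simp [trace, mul_apply, Fintype.sum_prod_type]
    simp only [sq (_ : ℝ)] at h1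
    rw [← Real.sqrt_mul]
    · refine (neg_le_abs _).trans (Real.abs_le_sqrt ?_)
      simp only [e, sq]
      exact h1
    · rw [e]
      exact Finset.sum_nonneg fun _ _ => mul_self_nonneg _
  set d := Real.sqrt (Dᵀ * D).trace with hd
  have hd0 : 0 ≤ d := Real.sqrt_nonneg _
  refine ⟨c / (d + 1), by positivity, le_csInf (hne.image _) ?_⟩
  rintro _ ⟨G, hG, rfl⟩
  have h1 : (Gᵀ * D).trace ≤ -c := by exact_mod_cast (hG D).trans hD
  have h2 := hcs G
  have h3 := Real.sqrt_nonneg (Gᵀ * G).trace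
  rw [div_le_iff₀ (by positivity)]
  linarith

/-- The weighted plant with the positive square roots of `Q` and `R` computes the cost of the state
feedback problem. -/
theorem cost_eq_hinf {nx nu nw : ℕ} (A : Matrix (Fin nx) (Fin nx) ℝ)
    (B : Matrix (Fin nx) (Fin nu) ℝ) (Bw : Matrix (Fin nx) (Fin nw) ℝ)
    (Q : Matrix (Fin nx) (Fin nx) ℝ) (R : Matrix (Fin nu) (Fin nu) ℝ) :
    cost A B Bw (1 : Matrix (Fin nx) (Fin nx) ℝ) Q R =
      (Plant.mk A B Bw (CFC.sqrt Q) (CFC.sqrt R)).hinf := by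
  ext K
  simp only [cost, Plant.hinf, sigmaMax_eq_norm, transferMatrix, Matrix.mul_one, Plant.transfer,
    Plant.output, Plant.pencil, Plant.closedLoop]

theorem det_sqrt_ne_zero {n : ℕ} {Q : Matrix (Fin n) (Fin n) ℝ} (hQ : Q.PosDef) :
    (CFC.sqrt Q).det ≠ 0 := by
  intro h
  have h1 := CFC.sqrt_mul_sqrt_self Q hQ.posSemidef.nonneg
  have h2 := congrArg Matrix.det h1
  rw [det_mul, h, zero_mul] at h2
  exact hQ.det_pos.ne h2

end HinfControl

end

theorem mainTheorem2 {nx nu nw : ℕ}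
    (A : Matrix (Fin nx) (Fin nx) ℝ) (B : Matrix (Fin nx) (Fin nu) ℝ)
    (Bw : Matrix (Fin nx) (Fin nw) ℝ)
    (Q : Matrix (Fin nx) (Fin nx) ℝ) (R : Matrix (Fin nu) (Fin nu) ℝ)
    (hstab : HinfControl.Stabilizable A B) (hBw : Bw.rank = nx)
    (hQ : Q.PosDef) (hR : R.PosDef) :
    ∃ Jstar : ℝ,
      IsLeast (HinfControl.cost A B Bw (1 : Matrix (Fin nx) (Fin nx) ℝ) Q R ''
        HinfControl.stabilizingGains A B (1 : Matrix (Fin nx) (Fin nx) ℝ)) Jstar ∧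
      ∀ K ∈ HinfControl.stabilizingGains A B (1 : Matrix (Fin nx) (Fin nx) ℝ),
        ∃ μ : ℝ, 0 < μ ∧
          μ * (HinfControl.cost A B Bw (1 : Matrix (Fin nx) (Fin nx) ℝ) Q R K - Jstar) ≤
            HinfControl.distZero (HinfControl.clarkeSubdifferential
              (HinfControl.cost A B Bw (1 : Matrix (Fin nx) (Fin nx) ℝ) Q R) K) := by
  obtain ⟨β, hβ0, hβ⟩ := HinfControl.exists_pos_le_transpose_mulVec hBw
  rw [HinfControl.cost_eq_hinf]
  set P := HinfControl.Plant.mk A B Bw (CFC.sqrt Q) (CFC.sqrt R) with hP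
  have hSq : P.Sq.det ≠ 0 := HinfControl.det_sqrt_ne_zero hQ
  have hSr : P.Sr.det ≠ 0 := HinfControl.det_sqrt_ne_zero hR
  have hgains : ∀ K, K ∈ HinfControl.stabilizingGains A B (1 : Matrix (Fin nx) (Fin nx) ℝ) ↔
      HinfControl.SchurStable (P.closedLoop K) := by
    intro K
    simp only [HinfControl.stabilizingGains, Matrix.mul_one, hP, HinfControl.Plant.closedLoop]
    rfl
  obtain ⟨K₁, hK₁, hmin⟩ := P.exists_optimal_gain hSq hSr hβ0 hβ hstab
  refine ⟨P.hinf K₁, ⟨⟨K₁, (hgains K₁).2 hK₁, rfl⟩, ?_⟩, fun K hK => ?_⟩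
  · rintro _ ⟨K, hK, rfl⟩
    exact hmin K ((hgains K).1 hK)
  · rw [hgains] at hK
    rcases (hmin K hK).eq_or_lt with heq | hlt
    · refine ⟨1, one_pos, ?_⟩
      rw [heq, sub_self, mul_zero]
      refine Real.sInf_nonneg ?_
      rintro _ ⟨G, _, rfl⟩
      exact Real.sqrt_nonneg _
    · have hreg := HinfControl.Plant.regular_of_schurStable hK
      obtain ⟨c, hc, d, hdesc⟩ := HinfControl.Plant.exists_descent hSq hβ0 hβ hK hK₁ hlt
      obtain ⟨D, hD⟩ := hreg.exists_clarkeDeriv_le hc hdesc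
      obtain ⟨δ, hδ, hle⟩ := HinfControl.exists_pos_le_distZero (half_pos hc) hD
        hreg.clarkeSubdifferential_nonempty
      have hgap := sub_pos.2 hlt
      refine ⟨δ / (P.hinf K - P.hinf K₁), div_pos hδ hgap, ?_⟩
      rwa [div_mul_cancel₀ _ hgap.ne']
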